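/- Let $0<c_0<1$ and $c_1>0$, and put $\tilde c_0=\frac{c_0}{1-c_0}$, $\tilde c_1=\frac{c_1}{1-c_0}$. Let $\mathbb H=H^1(0,1)\times L^2(0,1)$ (real spaces) with the norm $\|(\phi,\psi)\|^2=\int_0^1(|\phi'|^2+|\psi|^2)\,dx+|\phi(0)|^2$, let $\mathbb H_0=\{(\phi,\psi)\in\mathbb H:\phi(1)=0\}$, and let $\mathcal A_0(\phi,\psi)=(\psi,\phi'')$ with $$D(\mathcal A_0)=\{(\phi,\psi)\in H^2(0,1)\times H^1(0,1):\ \phi(1)=\psi(1)=0,\ \phi'(0)=\tilde c_1\phi(0)+\tilde c_0\psi(0)\}.$$ This operator describes the system $\beta_{tt}=\beta_{xx}$, $\beta_x(0,t)=\tilde c_1\beta(0,t)+\tilde c_0\beta_t(0,t)$, $\beta(1,t)=0$. (a) $\mathcal A_0$ generates an exponentially stable strongly continuous semigroup $e^{\mathcal A_0t}$ on $\mathbb H_0$, and the observation operator $C:D(\mathcal A_0)\to\mathbb R$, $C(\beta_0,\beta_1)=\beta_0'(1)$, is admissible for it: $C$ is bounded for the graph norm, and for every $\tau>0$ there is $K_\tau$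 such that $\int_0^\tau|Ce^{\mathcal A_0t}b|^2dt\le K_\tau\|b\|^2$ for all $b\in D(\mathcal A_0)$. (b) The map $b\mapsto Ce^{\mathcal A_0t}b$, $b\in D(\mathcal A_0)$, extends to a bounded operator $\Psi:\mathbb H_0\to L^2[0,\infty)$, and for every $b\in\mathbb H_0$ the function $\Psi b$ is the Neumann trace $\beta_x(1,\cdot)$ of $(\beta,\beta_t)=e^{\mathcal A_0t}b$. (c) Let $q>0$, let $f:\mathbb H\to\mathbb R$ be continuous, let $u,d\in L^2_{loc}[0,\infty)$ (for instance $d\in L^\infty[0,\infty)$), and let $(w,w_t),(v,v_t),(z,z_t)\in C([0,\infty);\mathbb H)$, $W\in C([0,\infty);H^1(0,1))$ be a finite energy (weak) solution of the plant $$w_{tt}=w_{xx},\quad w_x(0,t)=-qw(0,t),\quad w_x(1,t)=u(t)+F(t),\quad F(t)=f(w(\cdot,t),w_t(\cdot,t))+d(t),$$ coupled with the disturbance estimator $$\begin{aligned}&v_{tt}=v_{xx},\quad v_x(0,t)=-qw(0,t)+c_1[v(0,t)-w(0,t)],\quad v_x(1,t)=u(t)-W_x(1,t),\\&z_{tt}=z_{xx},\quad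 z_x(0,t)=\tilde c_1z(0,t)+\tilde c_0z_t(0,t),\quad z(1,t)=-v(1,t)+w(1,t)-W(1,t),\\&W_t=-W_x,\quad W(0,t)=-c_0[v(0,t)-w(0,t)].\end{aligned}$$ Put $p=w-v-W$ and $\beta=z-p$. Then $(\beta(\cdot,t),\beta_t(\cdot,t))=e^{\mathcal A_0t}b$ for all $t\ge0$, where $b=(\beta(\cdot,0),\beta_t(\cdot,0))\in\mathbb H_0$; the Neumann trace $\widehat F=z_x(1,\cdot)$ exists as a locally integrable function on $[0,\infty)$; and $\widehat F-F=\beta_x(1,\cdot)=\Psi b$ almost everywhere, so that $\widehat F-F\in L^2[0,\infty)$. Here, for $(y,y_t)\in C([0,\infty);\mathbb H)$ with $y_t$ the time derivative of $y$ in $L^2(0,1)$, the wave equation and Neumann data are understood weakly: $y_{tt}=y_{xx}$ with $y_x(0,\cdot)=g_0$, $y_x(1,\cdot)=g_1$ means that for all $t\ge0$ and $\eta\in H^1(0,1)$ $$\int_0^1\!\big(y_t(x,t)-y_t(x,0)\big)\eta(x)\,dx+\int_0^t\!\!\int_0^1y_x\eta'\,dx\,ds=\eta(1)\!\int_0^t\!g_1\,ds-\eta(0)\!\int_0^t\!g_0\,ds;$$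 where the datum at an endpoint is not prescribed or is to be left out of consideration, only $\eta$ vanishing at that endpoint are used. Moreover $\int_0^tz_t(0,s)\,ds$ stands for $z(0,t)-z(0,0)$ and $\int_0^tW_x(1,s)\,ds$ for $W(1,0)-W(1,t)$. -/

import Mathlib

open MeasureTheory Set Filter Topology
open scoped NNReal ENNReal

noncomputable section

namespace WaveEstimator

/-! ### Strongly continuous semigroups, generators, admissible observation operators -/

/-- A strongly continuous (C₀) semigroup of bounded operators on a real normed space. -/
structure C0Semigroup (X : Type*) [NormedAddCommGroup X] [NormedSpace ℝ X] where
  toFun : ℝ≥0 → X →L[ℝ] X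
  map_zero : toFun 0 = ContinuousLinearMap.id ℝ X
  map_add : ∀ s t : ℝ≥0, toFun (s + t) = (toFun s).comp (toFun t)
  tendsto_zero : ∀ x : X, Tendsto (fun t : ℝ≥0 => toFun t x) (𝓝 0) (𝓝 x)

namespace C0Semigroup

variable {X : Type*} [NormedAddCommGroup X] [NormedSpace ℝ X]

/-- `A` is the infinitesimal generator of the semigroup `T`: the pairs `(x, A x)`, `x ∈ D(A)`, are
exactly the pairs `(x, y)` with `(T h x - x) / h → y` as `h ↓ 0`. -/
def HasGenerator (T : C0Semigroup X) (A : X →ₗ.[ℝ] X) : Prop :=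
  ∀ x y : X, (x, y) ∈ A.graph ↔
    Tendsto (fun h : ℝ => h⁻¹ • (T.toFun h.toNNReal x - x)) (𝓝[>] 0) (𝓝 y)

/-- Exponential stability: `‖T t‖ ≤ M e^{-ω t}` for some `M` and some `ω > 0`. -/
def ExponentiallyStable (T : C0Semigroup X) : Prop :=
  ∃ M ω : ℝ, 0 < ω ∧ ∀ t : ℝ≥0, ‖T.toFun t‖ ≤ M * Real.exp (-ω * t)

/-- The domain of the generator is invariant under the semigroup. -/
theorem HasGenerator.apply_mem_domain {T : C0Semigroup X} {A : X →ₗ.[ℝ] X}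
    (hT : T.HasGenerator A) (x : A.domain) (t : ℝ≥0) : T.toFun t (x : X) ∈ A.domain := by
  have h1 := (hT x (A x)).1 (A.mem_graph x)
  have h2 : (T.toFun t (x : X), T.toFun t (A x)) ∈ A.graph := by
    refine (hT _ _).2 ?_
    have h3 := ((T.toFun t).continuous.tendsto (A x)).comp h1
    refine h3.congr fun h => ?_
    have h4 : T.toFun h.toNNReal (T.toFun t (x : X)) = T.toFun t (T.toFun h.toNNReal (x : X)) := by
      rw [← ContinuousLinearMap.comp_apply, ← ContinuousLinearMap.comp_apply, ← T.map_add,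
        ← T.map_add, add_comm]
    simp [h4]
  exact LinearPMap.mem_domain_of_mem_graph h2

/-- The trajectory `t ↦ T t x` of a point `x` of `D(A)`, as a trajectory in `D(A)`. -/
def HasGenerator.orbit {T : C0Semigroup X} {A : X →ₗ.[ℝ] X} (hT : T.HasGenerator A)
    (x : A.domain) (t : ℝ≥0) : A.domain :=
  ⟨T.toFun t (x : X), hT.apply_mem_domain x t⟩

/-- `C : D(A) → Y` is an admissible observation operator for the semigroup `T` generated by `A`:
it is bounded for the graph norm of `D(A)`, and for every `τ > 0` there is `K` such that
`∫₀^τ ‖C (T t x)‖² dt ≤ K ‖x‖²` for all `x ∈ D(A)`. -/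
def HasGenerator.IsAdmissible {T : C0Semigroup X} {A : X →ₗ.[ℝ] X} (hT : T.HasGenerator A)
    {Y : Type*} [NormedAddCommGroup Y] [NormedSpace ℝ Y] (C : A.domain →ₗ[ℝ] Y) : Prop :=
  (∃ K : ℝ, ∀ x : A.domain, ‖C x‖ ≤ K * (‖(x : X)‖ + ‖A x‖)) ∧
  ∀ τ : ℝ, 0 < τ → ∃ K : ℝ≥0, ∀ x : A.domain,
    ∫⁻ t in Ioc 0 τ, ‖C (hT.orbit x t.toNNReal)‖ₑ ^ 2 ≤ K * ‖(x : X)‖ₑ ^ 2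

end C0Semigroup

/-! ### The Sobolev space `H¹(0,1)` -/

/-- The real space `L²(0,1)`. -/
abbrev L2 : Type := Lp ℝ 2 (volume.restrict (Ioo (0 : ℝ) 1))

/-- The real Sobolev space `H¹(0,1)`. A function `φ` of this space is recorded by the pair
`(φ(0), φ')` in `ℝ × L²(0,1)`, from which it is recovered as `φ(x) = φ(0) + ∫₀ˣ φ'`; the norm is
`(|φ(0)|² + ∫₀¹ |φ'|²)^{1/2}`, which is equivalent to the usual one.
See `H1.absolutelyContinuousOnInterval_eval` and `H1.existsUnique_of_absolutelyContinuous` for the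
identification with the absolutely continuous functions with square integrable derivative. -/
abbrev H1 : Type := WithLp 2 (ℝ × L2)

namespace H1

/-- The (weak) derivative `φ'`. -/
def deriv (φ : H1) : L2 := φ.snd

/-- The value `φ(x)`, for `x ∈ [0,1]`, of the continuous representative of `φ`. -/
def eval (φ : H1) (x : ℝ) : ℝ := φ.fst + ∫ r in (0 : ℝ)..x, deriv φ r

theorem integrableOn_L2 (g : L2) : IntegrableOn g (Ioo (0 : ℝ) 1) :=
  (Lp.memLp g).integrable (by norm_num)

theorem intervalIntegrable_L2 (g : L2) : IntervalIntegrable g volume 0 1 :=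
  (intervalIntegrable_iff_integrableOn_Ioo_of_le zero_le_one).2 (integrableOn_L2 g)

theorem intervalIntegrable_L2_of_mem (g : L2) {x : ℝ} (hx : x ∈ Icc (0 : ℝ) 1) :
    IntervalIntegrable g volume 0 x :=
  (intervalIntegrable_L2 g).mono_set (by
    rw [uIcc_of_le hx.1, uIcc_of_le zero_le_one]; exact Icc_subset_Icc_right hx.2)

theorem integral_congr_L2 {g h : ℝ → ℝ} (hgh : g =ᵐ[volume.restrict (Ioo (0 : ℝ) 1)] h) {x : ℝ}
    (hx : x ∈ Icc (0 : ℝ) 1) : ∫ r in (0 : ℝ)..x, g r = ∫ r in (0 : ℝ)..x, h r := by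
  rw [intervalIntegral.integral_of_le hx.1, intervalIntegral.integral_of_le hx.1,
    integral_Ioc_eq_integral_Ioo, integral_Ioc_eq_integral_Ioo]
  exact integral_congr_ae
    (ae_mono (Measure.restrict_mono (Ioo_subset_Ioo_right hx.2) le_rfl) hgh)

theorem eval_add (φ ψ : H1) {x : ℝ} (hx : x ∈ Icc (0 : ℝ) 1) :
    eval (φ + ψ) x = eval φ x + eval ψ x := by
  have h : ∫ r in (0 : ℝ)..x, deriv (φ + ψ) r
      = ∫ r in (0 : ℝ)..x, (deriv φ r + deriv ψ r) :=
    integral_congr_L2 (Lp.coeFn_add (deriv φ) (deriv ψ)) hx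
  rw [intervalIntegral.integral_add (intervalIntegrable_L2_of_mem _ hx)
    (intervalIntegrable_L2_of_mem _ hx)] at h
  simp only [eval, h, WithLp.add_fst]
  ring

theorem eval_smul (c : ℝ) (φ : H1) {x : ℝ} (hx : x ∈ Icc (0 : ℝ) 1) :
    eval (c • φ) x = c * eval φ x := by
  have h : ∫ r in (0 : ℝ)..x, deriv (c • φ) r = ∫ r in (0 : ℝ)..x, c * deriv φ r :=
    integral_congr_L2 (Lp.coeFn_smul c (deriv φ)) hx
  rw [intervalIntegral.integral_const_mul] at h
  simp only [eval, h, WithLp.smul_fst, smul_eq_mul]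
  ring

theorem eval_zero_fun {x : ℝ} (hx : x ∈ Icc (0 : ℝ) 1) : eval 0 x = 0 := by
  simpa using eval_smul 0 (0 : H1) hx

theorem eval_left (φ : H1) : eval φ 0 = φ.fst := by simp [eval]

theorem continuousOn_eval (φ : H1) : ContinuousOn (eval φ) (Icc 0 1) := by
  have h := intervalIntegral.continuousOn_primitive_interval'
    (intervalIntegrable_L2 (deriv φ)) (left_mem_uIcc)
  rw [uIcc_of_le zero_le_one] at h
  exact continuousOn_const.add h

theorem memLp_eval (φ : H1) : MemLp (eval φ) 2 (volume.restrict (Ioo (0 : ℝ) 1)) := by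
  obtain ⟨K, hK⟩ := isCompact_Icc.exists_bound_of_continuousOn (continuousOn_eval φ)
  refine MemLp.of_bound
    (((continuousOn_eval φ).mono Ioo_subset_Icc_self).aestronglyMeasurable measurableSet_Ioo) K ?_
  exact (ae_restrict_iff' measurableSet_Ioo).2
    (Eventually.of_forall fun x hx => hK x (Ioo_subset_Icc_self hx))

/-- The inclusion of `H¹(0,1)` in `L²(0,1)`. -/
def toL2 : H1 →ₗ[ℝ] L2 where
  toFun φ := (memLp_eval φ).toLp
  map_add' φ ψ := by
    rw [← MemLp.toLp_add (memLp_eval φ) (memLp_eval ψ)]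
    refine MemLp.toLp_congr _ _ ((ae_restrict_iff' measurableSet_Ioo).2
      (Eventually.of_forall fun x hx => ?_))
    simpa using eval_add φ ψ (Ioo_subset_Icc_self hx)
  map_smul' c φ := by
    simp only [RingHom.id_apply]
    rw [← MemLp.toLp_const_smul c (memLp_eval φ)]
    refine MemLp.toLp_congr _ _ ((ae_restrict_iff' measurableSet_Ioo).2
      (Eventually.of_forall fun x hx => ?_))
    simpa using eval_smul c φ (Ioo_subset_Icc_self hx)

theorem coeFn_toL2 (φ : H1) : toL2 φ =ᵐ[volume.restrict (Ioo (0 : ℝ) 1)] eval φ :=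
  (memLp_eval φ).coeFn_toLp

theorem ae_hasDerivAt_eval (φ : H1) :
    ∀ᵐ x ∂(volume.restrict (Ioo (0 : ℝ) 1)), HasDerivAt (eval φ) (deriv φ x) x := by
  refine (ae_restrict_iff' measurableSet_Ioo).2 ?_
  filter_upwards [(intervalIntegrable_L2 (deriv φ)).ae_hasDerivAt_integral] with x hx hx1
  have := hx (by rw [uIcc_of_le zero_le_one]; exact Ioo_subset_Icc_self hx1) 0 left_mem_uIcc
  exact this.const_add φ.fst

theorem ext_eval {φ ψ : H1} (h : ∀ x ∈ Ioo (0 : ℝ) 1, eval φ x = eval ψ x) : φ = ψ := by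
  have h0 : φ.fst = ψ.fst := by
    have hcl : EqOn (eval φ) (eval ψ) (Icc 0 1) := by
      refine EqOn.of_subset_closure (s := Ioo (0 : ℝ) 1) h (continuousOn_eval φ)
        (continuousOn_eval ψ) Ioo_subset_Icc_self ?_
      rw [closure_Ioo zero_ne_one]
    simpa [eval_left] using hcl (left_mem_Icc.2 zero_le_one)
  have h1 : deriv φ = deriv ψ := by
    refine Lp.ext ?_
    filter_upwards [ae_hasDerivAt_eval φ, ae_hasDerivAt_eval ψ,
      self_mem_ae_restrict measurableSet_Ioo] with x hx1 hx2 hx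
    refine hx1.unique (hx2.congr_of_eventuallyEq ?_)
    filter_upwards [isOpen_Ioo.mem_nhds hx] with y hy using h y hy
  exact (WithLp.ofLp_injective 2) (Prod.ext h0 h1)

theorem toL2_injective : Function.Injective toL2 := by
  intro φ ψ h
  have hae : eval φ =ᵐ[volume.restrict (Ioo (0 : ℝ) 1)] eval ψ :=
    (coeFn_toL2 φ).symm.trans (h ▸ coeFn_toL2 ψ)
  refine ext_eval fun x hx => ?_
  exact Measure.eqOn_open_of_ae_eq hae isOpen_Ioo
    ((continuousOn_eval φ).mono Ioo_subset_Icc_self)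
    ((continuousOn_eval ψ).mono Ioo_subset_Icc_self) hx

/-- Every element of `H1` is an absolutely continuous function on `[0,1]`
(with derivative `deriv φ ∈ L²(0,1)`, by `ae_hasDerivAt_eval`). -/
theorem absolutelyContinuousOnInterval_eval (φ : H1) :
    AbsolutelyContinuousOnInterval (eval φ) 0 1 :=
  (contDiff_const (c := φ.fst) (n := 1)).contDiffOn.absolutelyContinuousOnInterval.add
    ((intervalIntegrable_L2 (deriv φ)).absolutelyContinuousOnInterval_intervalIntegral
      left_mem_uIcc)

/-- Every absolutely continuous function on `[0,1]` with derivative in `L²(0,1)` is given by a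
unique element of `H1`. -/
theorem existsUnique_of_absolutelyContinuous {f : ℝ → ℝ}
    (hf : AbsolutelyContinuousOnInterval f 0 1)
    (hf2 : MemLp (_root_.deriv f) 2 (volume.restrict (Ioo (0 : ℝ) 1))) :
    ∃! φ : H1, ∀ x ∈ Icc (0 : ℝ) 1, eval φ x = f x := by
  have key : ∀ x ∈ Icc (0 : ℝ) 1, eval (WithLp.toLp 2 (f 0, hf2.toLp)) x = f x := by
    intro x hx
    have h1 : ∫ r in (0 : ℝ)..x, deriv (WithLp.toLp 2 (f 0, hf2.toLp)) r
        = ∫ r in (0 : ℝ)..x, _root_.deriv f r := integral_congr_L2 hf2.coeFn_toLp hx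
    have h2 := (hf.mono (c := 0) (d := x) (by
      rw [uIcc_of_le hx.1, uIcc_of_le zero_le_one]
      exact Icc_subset_Icc_right hx.2)).integral_deriv_eq_sub
    simp only [eval, h1, h2]
    simp
  refine ⟨_, key, fun ψ hψ => ext_eval fun x hx => ?_⟩
  rw [hψ x (Ioo_subset_Icc_self hx), key x (Ioo_subset_Icc_self hx)]

/-- The inverse of the inclusion of `H¹(0,1)` in `L²(0,1)`: an element of `L²(0,1)` that lies in
`H¹(0,1)` is regarded as an element of `H¹(0,1)`. -/
def ofL2 : LinearMap.range toL2 ≃ₗ[ℝ] H1 :=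
  (LinearEquiv.ofInjective toL2 toL2_injective).symm

end H1

/-! ### The state spaces and the generator of the error system -/

/-- The energy space `H¹(0,1) × L²(0,1)`, with the norm
`‖(φ, ψ)‖² = ∫₀¹ (|φ'|² + |ψ|²) + |φ(0)|²`. -/
abbrev Energy : Type := WithLp 2 (H1 × L2)

/-- The first component (displacement) of a state. -/
def disp (x : Energy) : H1 := x.fst

/-- The second component (velocity) of a state. -/
def vel (x : Energy) : L2 := x.snd

/-- The state `(φ, ψ)`. -/
def mkState (φ : H1) (ψ : L2) : Energy := WithLp.toLp 2 (φ, ψ)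

theorem norm_sq_eq (x : Energy) :
    ‖x‖ ^ 2 = (∫ r in Ioo (0 : ℝ) 1, ((disp x).deriv r ^ 2 + vel x r ^ 2))
      + (disp x).eval 0 ^ 2 := by
  have key : ∀ g : L2, ‖g‖ ^ 2 = ∫ r in Ioo (0 : ℝ) 1, g r ^ 2 := by
    intro g
    rw [← real_inner_self_eq_norm_sq, MeasureTheory.L2.inner_def]
    simp [sq]
  have hint : ∀ g : L2, Integrable (fun r => g r ^ 2) (volume.restrict (Ioo (0 : ℝ) 1)) :=
    fun g => (Lp.memLp g).integrable_sq
  rw [integral_add (hint _) (hint _), ← key, ← key, WithLp.prod_norm_sq_eq_of_L2,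
    WithLp.prod_norm_sq_eq_of_L2, H1.eval_left]
  simp only [disp, vel, H1.deriv, Real.norm_eq_abs, sq_abs]
  ring

/-- The closed subspace `{(φ, ψ) ∈ H¹(0,1) × L²(0,1) : φ(1) = 0}` of the energy space. -/
def Energy0 : Submodule ℝ Energy where
  carrier := {x | (disp x).eval 1 = 0}
  zero_mem' := H1.eval_zero_fun (by simp)
  add_mem' {x y} hx hy := by
    have h := H1.eval_add (disp x) (disp y) (x := 1) (by simp)
    simp only [mem_ofPred_eq] at hx hy ⊢
    rw [hx, hy, add_zero] at h
    exact h
  smul_mem' c x hx := by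
    have h := H1.eval_smul c (disp x) (x := 1) (by simp)
    simp only [mem_ofPred_eq] at hx ⊢
    rw [hx, mul_zero] at h
    exact h

/-- The pairs `(φ, ψ)` in `H²(0,1) × H¹(0,1)` with `φ(1) = 0`: `φ' ∈ H¹(0,1)` and `ψ ∈ H¹(0,1)`. -/
def regular : Submodule ℝ Energy0 :=
  (LinearMap.range H1.toL2).comap
      ((WithLp.sndₗ 2 ℝ ℝ L2).comp ((WithLp.fstₗ 2 ℝ H1 L2).comp Energy0.subtype)) ⊓
    (LinearMap.range H1.toL2).comap ((WithLp.sndₗ 2 ℝ H1 L2).comp Energy0.subtype)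

/-- The derivative `φ' ∈ H¹(0,1)` of the first component of a regular pair `(φ, ψ)`. -/
def slope : regular →ₗ[ℝ] H1 where
  toFun x := H1.ofL2 ⟨(disp x.1.1).deriv, x.2.1⟩
  map_add' x y := by rw [← map_add]; rfl
  map_smul' c x := by rw [RingHom.id_apply, ← map_smul]; rfl

/-- The second component `ψ ∈ H¹(0,1)` of a regular pair `(φ, ψ)`. -/
def speed : regular →ₗ[ℝ] H1 where
  toFun x := H1.ofL2 ⟨vel x.1.1, x.2.2⟩
  map_add' x y := by rw [← map_add]; rfl
  map_smul' c x := by rw [RingHom.id_apply, ← map_smul]; rfl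

theorem toL2_slope (x : regular) : H1.toL2 (slope x) = (disp x.1.1).deriv :=
  congrArg Subtype.val ((LinearEquiv.ofInjective H1.toL2 H1.toL2_injective).apply_symm_apply
    ⟨(disp x.1.1).deriv, x.2.1⟩)

theorem toL2_speed (x : regular) : H1.toL2 (speed x) = vel x.1.1 :=
  congrArg Subtype.val ((LinearEquiv.ofInjective H1.toL2 H1.toL2_injective).apply_symm_apply
    ⟨vel x.1.1, x.2.2⟩)

/-- The domain of the generator: the pairs `(φ, ψ)` in `H²(0,1) × H¹(0,1)` with `φ(1) = 0`,
`ψ(1) = 0` and `φ'(0) = k₁ φ(0) + k₀ ψ(0)`. -/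
def waveDomain (k₁ k₀ : ℝ) : Submodule ℝ Energy0 where
  carrier := {x | ∃ h : x ∈ regular, (speed ⟨x, h⟩).eval 1 = 0 ∧
    (slope ⟨x, h⟩).eval 0 = k₁ * (disp x).eval 0 + k₀ * (speed ⟨x, h⟩).eval 0}
  zero_mem' := by
    have h0 : (⟨0, regular.zero_mem⟩ : regular) = 0 := rfl
    refine ⟨regular.zero_mem, ?_, ?_⟩
    · rw [h0, map_zero, H1.eval_zero_fun (by simp)]
    · rw [h0, map_zero, map_zero, H1.eval_zero_fun (by simp)]
      simp [disp, H1.eval_left]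
  add_mem' {x y} := by
    rintro ⟨hx, hx1, hx2⟩ ⟨hy, hy1, hy2⟩
    have h0 : (⟨x + y, regular.add_mem hx hy⟩ : regular) = ⟨x, hx⟩ + ⟨y, hy⟩ := rfl
    have h1 := H1.eval_add (disp x) (disp y) (x := 0) (by simp)
    have h2 : disp ((x + y : Energy0) : Energy) = disp x + disp y := rfl
    refine ⟨regular.add_mem hx hy, ?_, ?_⟩
    · rw [h0, map_add, H1.eval_add _ _ (by simp), hx1, hy1, add_zero]
    · rw [h0, map_add, map_add, H1.eval_add _ _ (by simp), H1.eval_add _ _ (by simp), h2, h1,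
        hx2, hy2]
      ring
  smul_mem' c x := by
    rintro ⟨hx, hx1, hx2⟩
    have h0 : (⟨c • x, regular.smul_mem c hx⟩ : regular) = c • ⟨x, hx⟩ := rfl
    have h1 := H1.eval_smul c (disp x) (x := 0) (by simp)
    have h2 : disp ((c • x : Energy0) : Energy) = c • disp x := rfl
    refine ⟨regular.smul_mem c hx, ?_, ?_⟩
    · rw [h0, map_smul, H1.eval_smul _ _ (by simp), hx1, mul_zero]
    · rw [h0, map_smul, map_smul, H1.eval_smul _ _ (by simp), H1.eval_smul _ _ (by simp), h2, h1,
        hx2]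
      ring

/-- The inclusion of the domain of the generator in the space of regular pairs. -/
def waveDomainIncl (k₁ k₀ : ℝ) : waveDomain k₁ k₀ →ₗ[ℝ] regular :=
  Submodule.inclusion fun _ h => h.1

/-- The generator `(φ, ψ) ↦ (ψ, φ'')` of the wave equation `β_tt = β_xx` on `(0,1)` with the
boundary conditions `β_x(0,t) = k₁ β(0,t) + k₀ β_t(0,t)` and `β(1,t) = 0`. -/
def waveGenerator (k₁ k₀ : ℝ) : Energy0 →ₗ.[ℝ] Energy0 where
  domain := waveDomain k₁ k₀
  toFun :=
    { toFun := fun x =>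
        ⟨mkState (speed (waveDomainIncl k₁ k₀ x)) (slope (waveDomainIncl k₁ k₀ x)).deriv,
          x.2.2.1⟩
      map_add' := fun x y => by simp only [map_add]; rfl
      map_smul' := fun c x => by simp only [map_smul]; rfl }

/-- The Neumann trace `(φ, ψ) ↦ φ'(1)` of a regular pair. -/
def neumannTrace : regular →ₗ[ℝ] ℝ where
  toFun x := (slope x).eval 1
  map_add' x y := by rw [map_add, H1.eval_add _ _ (by simp)]
  map_smul' c x := by rw [map_smul, H1.eval_smul _ _ (by simp)]; rfl

/-- The Neumann observation `C(φ, ψ) = φ'(1)` on the domain of the generator. -/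
def neumannObservation (k₁ k₀ : ℝ) : (waveGenerator k₁ k₀).domain →ₗ[ℝ] ℝ :=
  neumannTrace.comp (waveDomainIncl k₁ k₀)

/-! ### Finite energy solutions of wave equations and their boundary traces

A trajectory `x : ℝ → Energy`, `x t = (y(·,t), y_t(·,t))`, is only considered for `t ≥ 0`.
For a smooth solution of `y_tt = y_xx` and `η ∈ H¹(0,1)`, integration by parts gives
`∫₀¹ (y_t(·,t) - y_t(·,0)) η + ∫₀ᵗ ∫₀¹ y_x(·,s) η' ds
  = (∫₀ᵗ y_x(1,s) ds) η(1) - (∫₀ᵗ y_x(0,s) ds) η(0)`,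
and these identities define solutions and Neumann traces in the finite energy class. -/

/-- The left side of the weak formulation. -/
def weakForm (x : ℝ → Energy) (t : ℝ) (η : H1) : ℝ :=
  inner ℝ (vel (x t) - vel (x 0)) (H1.toL2 η)
    + ∫ s in (0 : ℝ)..t, inner ℝ (disp (x s)).deriv η.deriv

/-- `x = (y, y_t) ∈ C([0,∞); H¹(0,1) × L²(0,1))` and `y` solves `y_tt = y_xx` in `(0,1)`. -/
structure IsWave (x : ℝ → Energy) : Prop where
  continuousOn : ContinuousOn x (Ici 0)
  disp_eq : ∀ t, 0 ≤ t →
    H1.toL2 (disp (x t)) - H1.toL2 (disp (x 0)) = ∫ s in (0 : ℝ)..t, vel (x s)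
  interior : ∀ t, 0 ≤ t → ∀ η : H1, η.eval 0 = 0 → η.eval 1 = 0 → weakForm x t η = 0

/-- `∫₀ᵗ y_x(0,s) ds = G t` for all `t ≥ 0`. -/
def HasLeftFlux (x : ℝ → Energy) (G : ℝ → ℝ) : Prop :=
  ∀ t, 0 ≤ t → ∀ η : H1, η.eval 1 = 0 → weakForm x t η = -(G t * η.eval 0)

/-- `∫₀ᵗ y_x(1,s) ds = G t` for all `t ≥ 0`. -/
def HasRightFlux (x : ℝ → Energy) (G : ℝ → ℝ) : Prop :=
  ∀ t, 0 ≤ t → ∀ η : H1, η.eval 0 = 0 → weakForm x t η = G t * η.eval 1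

/-- The locally integrable function `g` is the Neumann trace `y_x(1,·)` on `[0,∞)`. -/
def IsRightNeumannTrace (x : ℝ → Energy) (g : ℝ → ℝ) : Prop :=
  (∀ τ : ℝ, IntegrableOn g (Ioc 0 τ)) ∧ HasRightFlux x fun t => ∫ s in (0 : ℝ)..t, g s

/-- `W ∈ C([0,∞); H¹(0,1))` solves the transport equation `W_t = -W_x` in `(0,1)`. -/
structure IsTransport (W : ℝ → H1) : Prop where
  continuousOn : ContinuousOn W (Ici 0)
  transport_eq : ∀ t, 0 ≤ t →
    H1.toL2 (W t) - H1.toL2 (W 0) = -∫ s in (0 : ℝ)..t, (W s).deriv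

/-- `g ∈ L²_loc[0,∞)`. -/
def IsL2Loc (g : ℝ → ℝ) : Prop :=
  ∀ τ : ℝ, MemLp g 2 (volume.restrict (Ioc 0 τ))

/-! ### The plant coupled with the disturbance estimator -/

/-- The total disturbance `F(t) = f(w(·,t), w_t(·,t)) + d(t)`. -/
def totalDisturbance (f : Energy → ℝ) (d : ℝ → ℝ) (w : ℝ → Energy) (t : ℝ) : ℝ :=
  f (w t) + d t

/-- Finite energy solutions of the plant, with state `w = (w, w_t)`,
`w_tt = w_xx`, `w_x(0,t) = -q w(0,t)`, `w_x(1,t) = u(t) + F(t)`,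
coupled with the total disturbance estimator, with state `v = (v, v_t)`, `z = (z, z_t)`, `W`,
`v_tt = v_xx`, `v_x(0,t) = -q w(0,t) + c₁ [v(0,t) - w(0,t)]`, `v_x(1,t) = u(t) - W_x(1,t)`,
`W_t = -W_x`, `W(0,t) = -c₀ [v(0,t) - w(0,t)]`,
`z_tt = z_xx`, `z_x(0,t) = c₁/(1-c₀) z(0,t) + c₀/(1-c₀) z_t(0,t)`,
`z(1,t) = -v(1,t) + w(1,t) - W(1,t)`.
The Neumann conditions are integrated over `[0,t]`; for `v_x(1,t)` one uses `-W_x = W_t`. -/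
structure IsPlantWithEstimator (q c₀ c₁ : ℝ) (f : Energy → ℝ) (u d : ℝ → ℝ)
    (w v z : ℝ → Energy) (W : ℝ → H1) : Prop where
  w_wave : IsWave w
  w_left : HasLeftFlux w fun t => ∫ s in (0 : ℝ)..t, -q * (disp (w s)).eval 0
  w_right : HasRightFlux w fun t => ∫ s in (0 : ℝ)..t, (u s + totalDisturbance f d w s)
  v_wave : IsWave v
  v_left : HasLeftFlux v fun t => ∫ s in (0 : ℝ)..t,
    (-q * (disp (w s)).eval 0 + c₁ * ((disp (v s)).eval 0 - (disp (w s)).eval 0))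
  v_right : HasRightFlux v fun t => (∫ s in (0 : ℝ)..t, u s) + ((W t).eval 1 - (W 0).eval 1)
  W_transport : IsTransport W
  W_left : ∀ t, 0 ≤ t → (W t).eval 0 = -c₀ * ((disp (v t)).eval 0 - (disp (w t)).eval 0)
  z_wave : IsWave z
  z_left : HasLeftFlux z fun t => (∫ s in (0 : ℝ)..t, c₁ / (1 - c₀) * (disp (z s)).eval 0)
    + c₀ / (1 - c₀) * ((disp (z t)).eval 0 - (disp (z 0)).eval 0)
  z_right : ∀ t, 0 ≤ t →
    (disp (z t)).eval 1 = -(disp (v t)).eval 1 + (disp (w t)).eval 1 - (W t).eval 1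

/-- The state `(p, p_t)` of `p = w - v - W`, where `p_t = w_t - v_t + W_x`. -/
def pState (w v : ℝ → Energy) (W : ℝ → H1) (t : ℝ) : Energy :=
  mkState (disp (w t) - disp (v t) - W t) (vel (w t) - vel (v t) + (W t).deriv)

end WaveEstimator

/-!
The generator `A` of the wave equation `β_tt = β_xx`, `β_x(0,t) = k₁ β(0,t) + k₀ β_t(0,t)`,
`β(1,t) = 0` has an explicit bounded inverse `R` (`mem_graph_iff_eq_inverse`), so everything about
`A` is expressed through bounded operators: `x ∈ D(A)` with `A x = y` means `x = R y`, and the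
observation `C` becomes the bounded functional `c = C R`.

All properties of the semigroup come from a single Lyapunov functional. There is a bounded
symmetric form `Q`, equivalent to the inner product of the energy space, with
`2 Q(x, A x) ≤ -|C x|² - ω ‖x‖²` on `D(A)` (`exists_isDissipativeInverse`). It is the energy plus
small perturbations: the multiplier `x - 2` produces the decay of the energy and the term
`-|φ'(1)|²`, and `φ(0) ∫ (1 - x) ψ` produces the decay of `φ(0)²`.

* Dissipativity and the bounded invertibility of `A` give the semigroup: the exponentials of the
  Yosida approximations `(R - ε)⁻¹` (which exist by the Lax–Milgram theorem) converge strongly as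
  `ε → 0`, because they are uniformly bounded and form a Cauchy family on the dense range of `R`
  (`norm_approx_sub_le`). Passing to the limit in the approximating equations gives
  `R (T(t) x - x) = ∫₀ᵗ T(s) x ds` (`apply_flow_sub`), which identifies the generator.
* Differentiating `Q(u, u)` along the orbit `u` of a point of `D(A)` gives exponential stability and
  `∫₀^∞ |C u|² ≤ Q(u(0), u(0))`, whence admissibility and the extended output map.
* A continuous solution of `R (u(t) - u(0)) = ∫₀ᵗ u` is an orbit, again because `Q` decreases
  (`eq_semigroup_of_integral_eq`). By integration by parts, the weak formulation of the boundary
  value problem is exactly this integrated equation (`inverse_sub_eq_integral`), and the integrated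
  Neumann trace at `1` of an orbit is `c (T(t) x - x)` (`hasRightFlux_semigroup`).
* For the coupled system, `(W, -W_x)` is itself a weak solution of the wave equation, so that
  `p = w - v - W` is one too. Its fluxes at `0` and at `1` are those of the target system and
  `∫₀ᵗ F`; hence `z - p` is an orbit of the semigroup, and its Neumann trace is `z_x(1,·) - F`.
-/

namespace WaveEstimator

/-! ### Generation of semigroups by operators with a dissipative bounded inverse -/

theorem le_add_mul_of_hasDerivAt_le {f f' : ℝ → ℝ} {C : ℝ} (hf : ∀ t, HasDerivAt f (f' t) t)
    (h : ∀ t, 0 ≤ t → f' t ≤ C) {t : ℝ} (ht : 0 ≤ t) : f t ≤ f 0 + C * t := by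
  have hd : ∀ s, HasDerivAt (fun s => f s - C * s) (f' s - C) s := fun s => by
    have h1 := (hf s).sub ((hasDerivAt_id s).const_mul C)
    rw [mul_one] at h1
    exact h1
  have hanti : AntitoneOn (fun s => f s - C * s) (Ici 0) := by
    refine antitoneOn_of_deriv_nonpos (convex_Ici 0)
      (fun s _ => (hd s).continuousAt.continuousWithinAt)
      (fun s _ => (hd s).differentiableAt.differentiableWithinAt) fun s hs => ?_
    rw [interior_Ici] at hs
    rw [(hd s).deriv]
    linarith [h s (le_of_lt hs)]
  have := hanti (mem_Ici.2 le_rfl) (mem_Ici.2 ht) ht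
  simp only [mul_zero, sub_zero] at this
  linarith

variable {X : Type*} [NormedAddCommGroup X] [InnerProductSpace ℝ X]

/-- The bounded operator `R` is injective and dissipative for the inner product `Q`, which is
equivalent to the given one by `b ‖x‖² ≤ Q(x, x)`. In the applications `R = A⁻¹` for an unbounded
operator `A`, and dissipativity of `R` is that of `A`, since `Q(R y, y) = Q(x, A x)` for
`x = R y`. -/
structure IsDissipativeInverse (R : X →L[ℝ] X) (Q : X →L[ℝ] X →L[ℝ] ℝ) (b : ℝ) : Prop where
  symm : ∀ x y, Q x y = Q y x
  pos : 0 < b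
  coercive : ∀ x, b * ‖x‖ ^ 2 ≤ Q x x
  nonpos : ∀ y, Q (R y) y ≤ 0
  injective : Function.Injective R

namespace IsDissipativeInverse

variable {R : X →L[ℝ] X} {Q : X →L[ℝ] X →L[ℝ] ℝ} {b : ℝ}

theorem apply_le (Q : X →L[ℝ] X →L[ℝ] ℝ) (x y : X) : Q x y ≤ ‖Q‖ * ‖x‖ * ‖y‖ :=
  (le_abs_self _).trans (Q.le_opNorm₂ x y)

theorem isCoercive (h : IsDissipativeInverse R Q b) : IsCoercive Q :=
  ⟨b, h.pos, fun x => by simpa [sq, mul_assoc] using h.coercive x⟩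

theorem hasDerivAt_form (h : IsDissipativeInverse R Q b) {u : ℝ → X} {u' : X} {t : ℝ}
    (hu : HasDerivAt u u' t) : HasDerivAt (fun s => Q (u s) (u s)) (2 * Q (u t) u') t := by
  have h1 : HasDerivAt (fun s => Q (u s)) (Q u') t := Q.hasFDerivAt.comp_hasDerivAt t hu
  have h2 := h1.clm_apply hu
  rw [h.symm u', ← two_mul] at h2
  exact h2

variable [CompleteSpace X]

/-- The range of a dissipative injective operator is dense: if `Q(v, R x) = 0` for all `x`, then
the nonpositive quadratic polynomial `Q(R(v + s x), v + s x)` in `s` has no constant term, so that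
its linear term `s Q(x, R v)` vanishes. -/
theorem denseRange (h : IsDissipativeInverse R Q b) : DenseRange R := by
  have h1 : (LinearMap.range (R : X →ₗ[ℝ] X)).topologicalClosure = ⊤ := by
    rw [Submodule.topologicalClosure_eq_top_iff, Submodule.eq_bot_iff]
    intro z hz
    obtain ⟨v, rfl⟩ := h.isCoercive.continuousLinearEquivOfBilin.surjective z
    have hv : ∀ x, Q v (R x) = 0 := fun x => by
      rw [← h.isCoercive.continuousLinearEquivOfBilin_apply, real_inner_comm]
      exact (Submodule.mem_orthogonal _ _).1 hz _ ⟨x, rfl⟩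
    have hq : ∀ s : ℝ, s * Q (R v) (R v) + s ^ 2 * Q (R (R v)) (R v) ≤ 0 := fun s => by
      have h2 := h.nonpos (v + s • R v)
      have h3 : Q (R (R v)) v = 0 := by rw [h.symm]; exact hv _
      have h4 : Q (R v) v = 0 := by rw [h.symm]; exact hv _
      simp only [map_add, map_smul, add_apply, smul_apply, smul_eq_mul, h3, h4] at h2
      linarith
    have h5 : Q (R v) (R v) ≤ 0 := by
      have hc : Tendsto (fun s : ℝ => Q (R v) (R v) + s * Q (R (R v)) (R v)) (𝓝[>] 0)
          (𝓝 (Q (R v) (R v) + 0 * Q (R (R v)) (R v))) :=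
        (Continuous.tendsto (by fun_prop) 0).mono_left nhdsWithin_le_nhds
      have h6 := le_of_tendsto (b := 0) hc (by
        filter_upwards [self_mem_nhdsWithin] with s (hs : 0 < s)
        have := hq s
        by_contra! hcon
        nlinarith)
      simpa using h6
    have h7 : R v = 0 := by
      have := h.coercive (R v)
      have hb := h.pos
      have h8 : ‖R v‖ ^ 2 ≤ 0 := by
        by_contra! hcon
        nlinarith
      simpa using h8
    have h8 : v = 0 := h.injective (by rw [h7, map_zero])
    rw [h8, map_zero]
  have h2 := Submodule.dense_iff_topologicalClosure_eq_top.2 h1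
  exact h2

/-- The operator `R - ε` is invertible: the form `Q((ε - R) x, y)` is coercive. -/
theorem exists_resolvent (h : IsDissipativeInverse R Q b) {ε : ℝ} (hε : 0 < ε) :
    ∃ S : X →L[ℝ] X, (∀ x, R (S x) = x + ε • S x) ∧ ∀ x, S (R x) = x + ε • S x := by
  set L : X →L[ℝ] X := ε • ContinuousLinearMap.id ℝ X - R
  have hL : ∀ x, L x = ε • x - R x := fun x => by simp [L]
  have hcL : IsCoercive (Q.comp L) := by
    refine ⟨ε * b, mul_pos hε h.pos, fun x => ?_⟩
    have h1 := h.coercive x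
    have h2 := h.nonpos x
    simp only [ContinuousLinearMap.comp_apply, hL, map_sub, map_smul, sub_apply, smul_apply,
      smul_eq_mul]
    nlinarith
  have h1 : ∀ x, hcL.continuousLinearEquivOfBilin x
      = h.isCoercive.continuousLinearEquivOfBilin (L x) := fun x =>
    h.isCoercive.unique_continuousLinearEquivOfBilin fun w => by
      rw [hcL.continuousLinearEquivOfBilin_apply]; rfl
  set G : X →L[ℝ] X := (hcL.continuousLinearEquivOfBilin.symm : X →L[ℝ] X).comp
    (h.isCoercive.continuousLinearEquivOfBilin : X →L[ℝ] X)
  have h2 : ∀ x, L (G x) = x := fun x => by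
    apply h.isCoercive.continuousLinearEquivOfBilin.injective
    rw [← h1]
    simp [G]
  have h3 : ∀ x, G (L x) = x := fun x => by
    simp [G, ← h1]
  refine ⟨-G, fun x => ?_, fun x => ?_⟩
  · have := h2 x
    rw [hL] at this
    simp only [neg_apply, map_neg, smul_neg]
    nth_rewrite 2 [← this]
    abel
  · have := h3 x
    rw [hL, map_sub, map_smul] at this
    simp only [neg_apply, smul_neg]
    nth_rewrite 2 [← this]
    abel

/-- The Yosida approximation `(R - ε)⁻¹ = A (1 - ε A)⁻¹` of `A = R⁻¹`, for `ε > 0`. -/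
def yosida (h : IsDissipativeInverse R Q b) (ε : ℝ) : X →L[ℝ] X :=
  if hε : 0 < ε then (h.exists_resolvent hε).choose else 0

theorem apply_yosida (h : IsDissipativeInverse R Q b) {ε : ℝ} (hε : 0 < ε) (x : X) :
    R (h.yosida ε x) = x + ε • h.yosida ε x := by
  rw [yosida, dif_pos hε]
  exact (h.exists_resolvent hε).choose_spec.1 x

theorem yosida_apply (h : IsDissipativeInverse R Q b) {ε : ℝ} (hε : 0 < ε) (x : X) :
    h.yosida ε (R x) = x + ε • h.yosida ε x := by
  rw [yosida, dif_pos hε]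
  exact (h.exists_resolvent hε).choose_spec.2 x

theorem norm_smul_yosida_le (h : IsDissipativeInverse R Q b) {ε : ℝ} (hε : 0 < ε) (x : X) :
    ‖ε • h.yosida ε x‖ ≤ ‖Q‖ / b * ‖x‖ := by
  set z := h.yosida ε x with hz
  have h1 := h.nonpos z
  rw [hz, h.apply_yosida hε, ← hz, map_add, map_smul, add_apply, smul_apply, smul_eq_mul] at h1
  have h2 := h.coercive z
  have h3 := apply_le Q (-x) z
  rw [map_neg, neg_apply, norm_neg] at h3
  rw [norm_smul, Real.norm_of_nonneg hε.le, div_mul_eq_mul_div, le_div_iff₀ h.pos]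
  rcases (norm_nonneg z).eq_or_lt with h0 | h0
  · rw [← h0]; simp; positivity
  · have h4 : (ε * b * ‖z‖) * ‖z‖ ≤ (‖Q‖ * ‖x‖) * ‖z‖ := by nlinarith
    have := le_of_mul_le_mul_right h4 h0
    linarith

/-- The semigroup `e^{t (R - ε)⁻¹}` generated by the Yosida approximation. -/
def approx (h : IsDissipativeInverse R Q b) (ε t : ℝ) : X →L[ℝ] X :=
  NormedSpace.exp (t • h.yosida ε)

theorem approx_zero (h : IsDissipativeInverse R Q b) (ε : ℝ) (x : X) : h.approx ε 0 x = x := by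
  simp [approx]

theorem approx_add (h : IsDissipativeInverse R Q b) (ε s t : ℝ) (x : X) :
    h.approx ε (s + t) x = h.approx ε s (h.approx ε t x) := by
  have : Commute (s • h.yosida ε) (t • h.yosida ε) :=
    ((Commute.refl (h.yosida ε)).smul_left s).smul_right t
  let _ : NormedAlgebra ℚ (X →L[ℝ] X) := NormedAlgebra.restrictScalars ℚ ℝ (X →L[ℝ] X)
  rw [approx, add_smul, NormedSpace.exp_add_of_commute this]
  rfl

theorem hasDerivAt_approx (h : IsDissipativeInverse R Q b) (ε t : ℝ) (x : X) :
    HasDerivAt (fun s => h.approx ε s x) (h.yosida ε (h.approx ε t x)) t := by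
  have h1 := hasDerivAt_exp_smul_const' (𝕂 := ℝ) (h.yosida ε) t
  simpa [approx] using h1.clm_apply (hasDerivAt_const t x)

theorem yosida_approx (h : IsDissipativeInverse R Q b) (ε t : ℝ) (x : X) :
    h.yosida ε (h.approx ε t x) = h.approx ε t (h.yosida ε x) := by
  have : Commute (h.yosida ε) (NormedSpace.exp (t • h.yosida ε)) :=
    ((Commute.refl (h.yosida ε)).smul_right t).exp_right
  exact congrArg (fun S : X →L[ℝ] X => S x) this.eq

theorem apply_approx (h : IsDissipativeInverse R Q b) {ε : ℝ} (hε : 0 < ε) (t : ℝ) (x : X) :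
    R (h.approx ε t x) = h.approx ε t (R x) := by
  have h0 : Commute R (h.yosida ε) := by
    refine ContinuousLinearMap.ext fun x => ?_
    change R (h.yosida ε x) = h.yosida ε (R x)
    rw [h.apply_yosida hε, h.yosida_apply hε]
  exact congrArg (fun S : X →L[ℝ] X => S x) (h0.smul_right t).exp_right.eq

/-- With `u' = (R - ε)⁻¹ u` one has `u = R u' - ε u'`, so that `Q(u, u') ≤ 0`. -/
theorem form_approx_le (h : IsDissipativeInverse R Q b) {ε : ℝ} (hε : 0 < ε) {t : ℝ}
    (ht : 0 ≤ t) (x : X) : Q (h.approx ε t x) (h.approx ε t x) ≤ Q x x := by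
  have h1 := le_add_mul_of_hasDerivAt_le (C := 0)
    (fun s => h.hasDerivAt_form (h.hasDerivAt_approx ε s x)) (fun s _ => ?_) ht
  · simpa [approx_zero] using h1
  · set u := h.approx ε s x
    have h2 := h.nonpos (h.yosida ε u)
    rw [h.apply_yosida hε, map_add, map_smul, add_apply, smul_apply, smul_eq_mul] at h2
    have h3 := h.coercive (h.yosida ε u)
    have h4 : 0 ≤ Q (h.yosida ε u) (h.yosida ε u) :=
      le_trans (mul_nonneg h.pos.le (by positivity)) h3
    nlinarith

theorem norm_approx_le (h : IsDissipativeInverse R Q b) {ε : ℝ} (hε : 0 < ε) {t : ℝ}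
    (ht : 0 ≤ t) (x : X) : ‖h.approx ε t x‖ ≤ √(‖Q‖ / b) * ‖x‖ := by
  have h1 := h.form_approx_le hε ht x
  have h2 := h.coercive (h.approx ε t x)
  have h3 := apply_le Q x x
  rw [← Real.sqrt_sq (norm_nonneg x), ← Real.sqrt_mul' _ (by positivity)]
  refine Real.le_sqrt_of_sq_le ?_
  rw [div_mul_eq_mul_div, le_div_iff₀ h.pos]
  linarith

/-- On the range of `R` the approximating semigroups form a Cauchy family. With
`w = u_ε - u_δ` one has `R w' = w + ε u_ε' - δ u_δ'`, so that dissipativity of `R` gives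
`Q(w', w) ≤ - Q(w', ε u_ε' - δ u_δ')`. -/
theorem norm_approx_sub_le (h : IsDissipativeInverse R Q b) : ∃ K : ℝ, ∀ ε δ : ℝ, 0 < ε → 0 < δ →
    ∀ t, 0 ≤ t → ∀ y,
      ‖h.approx ε t (R y) - h.approx δ t (R y)‖ ^ 2 ≤ K * (ε + δ) * t * ‖y‖ ^ 2 := by
  set L : ℝ := √(‖Q‖ / b) * (1 + ‖Q‖ / b)
  have hb := h.pos
  have hL0 : 0 ≤ L := by positivity
  have hder : ∀ ε : ℝ, 0 < ε → ∀ t, 0 ≤ t → ∀ y,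
      ‖h.yosida ε (h.approx ε t (R y))‖ ≤ L * ‖y‖ := by
    intro ε hε t ht y
    rw [h.yosida_approx, h.yosida_apply hε]
    refine (h.norm_approx_le hε ht _).trans ?_
    have h1 := h.norm_smul_yosida_le hε y
    have h2 := norm_add_le y (ε • h.yosida ε y)
    calc _ ≤ √(‖Q‖ / b) * (‖y‖ + ‖Q‖ / b * ‖y‖) := by gcongr; linarith
      _ = L * ‖y‖ := by ring
  refine ⟨4 * ‖Q‖ * L ^ 2 / b, fun ε δ hε hδ t ht y => ?_⟩
  have h1 := le_add_mul_of_hasDerivAt_le (C := 4 * ‖Q‖ * L ^ 2 * (ε + δ) * ‖y‖ ^ 2)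
    (fun s => h.hasDerivAt_form
      ((h.hasDerivAt_approx ε s (R y)).sub (h.hasDerivAt_approx δ s (R y)))) (fun s hs => ?_) ht
  · have h2 := h.coercive (h.approx ε t (R y) - h.approx δ t (R y))
    simp only [Pi.sub_apply, approx_zero, sub_self, map_zero, zero_add] at h1
    have h3 : 4 * ‖Q‖ * L ^ 2 / b * (ε + δ) * t * ‖y‖ ^ 2
        = (4 * ‖Q‖ * L ^ 2 * (ε + δ) * ‖y‖ ^ 2 * t) / b := by ring
    rw [h3, le_div_iff₀ hb]
    linarith
  · simp only [Pi.sub_apply]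
    have ha := hder ε hε s hs y
    have hc := hder δ hδ s hs y
    have h2 := h.apply_yosida hε (h.approx ε s (R y))
    have h3 := h.apply_yosida hδ (h.approx δ s (R y))
    set u := h.approx ε s (R y)
    set v := h.approx δ s (R y)
    set u' := h.yosida ε u
    set v' := h.yosida δ v
    have h4 := h.nonpos (u' - v')
    have h5 : R (u' - v') = (u - v) - (δ • v' - ε • u') := by
      rw [map_sub, h2, h3]; abel
    rw [h5, map_sub Q, sub_apply] at h4
    have h6 := apply_le Q (δ • v' - ε • u') (u' - v')
    have h7 : ‖u' - v'‖ ≤ 2 * L * ‖y‖ := (norm_sub_le _ _).trans (by linarith)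
    have h8 : ‖δ • v' - ε • u'‖ ≤ (ε + δ) * (L * ‖y‖) := by
      refine (norm_sub_le _ _).trans ?_
      rw [norm_smul, norm_smul, Real.norm_of_nonneg hε.le, Real.norm_of_nonneg hδ.le]
      nlinarith
    have h9 : ‖Q‖ * ‖δ • v' - ε • u'‖ * ‖u' - v'‖
        ≤ ‖Q‖ * ((ε + δ) * (L * ‖y‖)) * (2 * L * ‖y‖) := by gcongr
    nlinarith

theorem cauchySeq_approx (h : IsDissipativeInverse R Q b) {t : ℝ} (ht : 0 ≤ t) (x : X) :
    CauchySeq fun n : ℕ => h.approx (1 / ((n : ℝ) + 1)) t x := by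
  obtain ⟨K, hK⟩ := h.norm_approx_sub_le
  set M := √(‖Q‖ / b)
  have hM : 0 ≤ M := Real.sqrt_nonneg _
  have hpos : ∀ n : ℕ, (0 : ℝ) < 1 / ((n : ℝ) + 1) := fun n => by positivity
  have hlim : Tendsto (fun n : ℕ => 1 / ((n : ℝ) + 1)) atTop (𝓝 0) :=
    tendsto_one_div_add_atTop_nhds_zero_nat
  -- The assertion for a point `R y`.
  have hR : ∀ y, CauchySeq fun n : ℕ => h.approx (1 / ((n : ℝ) + 1)) t (R y) := by
    intro y
    rw [cauchySeq_iff_tendsto_dist_atTop_0]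
    have h1 : Tendsto (fun p : ℕ × ℕ => √(K * (1 / ((p.1 : ℝ) + 1) + 1 / ((p.2 : ℝ) + 1))
        * t * ‖y‖ ^ 2)) atTop (𝓝 (√(K * (0 + 0) * t * ‖y‖ ^ 2))) := by
      rw [← prod_atTop_atTop_eq]
      exact ((((hlim.comp tendsto_fst).add (hlim.comp tendsto_snd)).const_mul K).mul_const
        t |>.mul_const (‖y‖ ^ 2)).sqrt
    simp only [add_zero, mul_zero, zero_mul, Real.sqrt_zero] at h1
    refine squeeze_zero (fun _ => dist_nonneg) (fun p => ?_) h1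
    rw [dist_eq_norm]
    exact Real.le_sqrt_of_sq_le (hK _ _ (hpos _) (hpos _) t ht y)
  rw [Metric.cauchySeq_iff']
  intro e he
  obtain ⟨y, hy⟩ := h.denseRange.exists_dist_lt x (show 0 < e / (3 * (M + 1)) by positivity)
  obtain ⟨N, hN⟩ := Metric.cauchySeq_iff'.1 (hR y) (e / 3) (by positivity)
  refine ⟨N, fun n hn => ?_⟩
  have h1 : ∀ n : ℕ, dist (h.approx (1 / ((n : ℝ) + 1)) t x)
      (h.approx (1 / ((n : ℝ) + 1)) t (R y)) < e / 3 := fun n => by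
    rw [dist_eq_norm, ← map_sub]
    refine (h.norm_approx_le (hpos n) ht _).trans_lt ?_
    rw [dist_eq_norm, lt_div_iff₀ (by positivity)] at hy
    nlinarith [norm_nonneg (x - R y)]
  have h2 := dist_triangle4 (h.approx (1 / ((n : ℝ) + 1)) t x)
    (h.approx (1 / ((n : ℝ) + 1)) t (R y)) (h.approx (1 / ((N : ℝ) + 1)) t (R y))
    (h.approx (1 / ((N : ℝ) + 1)) t x)
  have h3 := h1 n
  have h4 := h1 N
  rw [dist_comm] at h4
  linarith [hN n hn]

/-- The strong limit `T(t)` of the semigroups generated by the Yosida approximations. -/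
def flow (h : IsDissipativeInverse R Q b) (t : ℝ≥0) : X →L[ℝ] X :=
  continuousLinearMapOfTendsto (l := atTop)
    (fun n : ℕ => h.approx (1 / ((n : ℝ) + 1)) (t : ℝ))
    (f := fun x => (cauchySeq_tendsto_of_complete (h.cauchySeq_approx t.2 x)).choose)
    (tendsto_pi_nhds.2 fun x =>
      (cauchySeq_tendsto_of_complete (h.cauchySeq_approx t.2 x)).choose_spec)

theorem tendsto_approx (h : IsDissipativeInverse R Q b) (t : ℝ≥0) (x : X) :
    Tendsto (fun n : ℕ => h.approx (1 / ((n : ℝ) + 1)) t x) atTop (𝓝 (h.flow t x)) :=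
  (cauchySeq_tendsto_of_complete (h.cauchySeq_approx t.2 x)).choose_spec

theorem norm_flow_le (h : IsDissipativeInverse R Q b) (t : ℝ≥0) (x : X) :
    ‖h.flow t x‖ ≤ √(‖Q‖ / b) * ‖x‖ :=
  le_of_tendsto (h.tendsto_approx t x).norm
    (Eventually.of_forall fun _ => h.norm_approx_le (by positivity) t.2 x)

theorem flow_zero (h : IsDissipativeInverse R Q b) (x : X) : h.flow 0 x = x :=
  tendsto_nhds_unique (h.tendsto_approx 0 x) (by simp [approx_zero])

theorem apply_flow (h : IsDissipativeInverse R Q b) (t : ℝ≥0) (x : X) :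
    R (h.flow t x) = h.flow t (R x) := by
  refine tendsto_nhds_unique ((R.continuous.tendsto _).comp (h.tendsto_approx t x))
    ((h.tendsto_approx t (R x)).congr fun n => ?_)
  exact (h.apply_approx (by positivity) _ _).symm

theorem flow_add (h : IsDissipativeInverse R Q b) (s t : ℝ≥0) (x : X) :
    h.flow (s + t) x = h.flow s (h.flow t x) := by
  refine tendsto_nhds_unique (h.tendsto_approx (s + t) x) ?_
  rw [← tendsto_sub_nhds_zero_iff]
  have h1 := (h.tendsto_approx s (h.flow t x)).sub_const (h.flow s (h.flow t x))
  have h2 := ((h.tendsto_approx t x).sub_const (h.flow t x)).norm.const_mul (√(‖Q‖ / b))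
  simp only [sub_self, norm_zero, mul_zero] at h1 h2
  have h3 : Tendsto (fun n : ℕ => h.approx (1 / ((n : ℝ) + 1)) s
      (h.approx (1 / ((n : ℝ) + 1)) t x - h.flow t x)) atTop (𝓝 0) :=
    squeeze_zero_norm (fun n => h.norm_approx_le (by positivity) s.2 _) h2
  have h4 := h3.add h1
  rw [add_zero] at h4
  refine h4.congr fun n => ?_
  rw [NNReal.coe_add, h.approx_add, map_sub]
  abel

/-- The integrated form of `u' = A u` for `u = T(·) x`: the limit `ε → 0` of the identity
`(R - ε)(u_ε(t) - x) = ∫₀ᵗ u_ε`. -/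
theorem apply_flow_sub (h : IsDissipativeInverse R Q b) {t : ℝ} (ht : 0 ≤ t) (x : X) :
    R (h.flow t.toNNReal x - x) = ∫ s in (0 : ℝ)..t, h.flow s.toNNReal x := by
  have hpos : ∀ n : ℕ, (0 : ℝ) < 1 / ((n : ℝ) + 1) := fun n => by positivity
  have hint : ∀ n : ℕ, ∫ s in (0 : ℝ)..t, h.approx (1 / ((n : ℝ) + 1)) s x
      = R (h.approx (1 / ((n : ℝ) + 1)) t x - x)
        - (1 / ((n : ℝ) + 1)) • (h.approx (1 / ((n : ℝ) + 1)) t x - x) := by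
    intro n
    have hc : Continuous fun s => h.approx (1 / ((n : ℝ) + 1)) s x :=
      continuous_iff_continuousAt.2 fun s => (h.hasDerivAt_approx _ s x).continuousAt
    have hd : ∀ s : ℝ, HasDerivAt (fun s => R (h.approx (1 / ((n : ℝ) + 1)) s x)
        - (1 / ((n : ℝ) + 1)) • h.approx (1 / ((n : ℝ) + 1)) s x)
        (h.approx (1 / ((n : ℝ) + 1)) s x) s := fun s => by
      have h1 := h.hasDerivAt_approx (1 / ((n : ℝ) + 1)) s x
      have h2 := (R.hasFDerivAt.comp_hasDerivAt s h1).sub (h1.const_smul (1 / ((n : ℝ) + 1)))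
      rw [h.apply_yosida (hpos n), add_sub_cancel_right] at h2
      exact h2
    rw [intervalIntegral.integral_eq_sub_of_hasDerivAt (fun s _ => hd s)
      (hc.intervalIntegrable _ _), approx_zero, map_sub, smul_sub]
    abel
  have h1 : Tendsto (fun n : ℕ => ∫ s in (0 : ℝ)..t, h.approx (1 / ((n : ℝ) + 1)) s x) atTop
      (𝓝 (∫ s in (0 : ℝ)..t, h.flow s.toNNReal x)) := by
    refine intervalIntegral.tendsto_integral_filter_of_dominated_convergence
      (fun _ => √(‖Q‖ / b) * ‖x‖) (Eventually.of_forall fun n => ?_)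
      (Eventually.of_forall fun n => ae_of_all _ fun s hs => ?_) (by simp)
      (ae_of_all _ fun s hs => ?_)
    · exact (continuous_iff_continuousAt.2 fun s =>
        (h.hasDerivAt_approx _ s x).continuousAt).aestronglyMeasurable
    · rw [uIoc_of_le ht] at hs
      exact h.norm_approx_le (hpos n) hs.1.le x
    · rw [uIoc_of_le ht] at hs
      have := h.tendsto_approx s.toNNReal x
      rwa [Real.coe_toNNReal _ hs.1.le] at this
  have h2 : Tendsto (fun n : ℕ => h.approx (1 / ((n : ℝ) + 1)) t x - x) atTop
      (𝓝 (h.flow t.toNNReal x - x)) := by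
    have := h.tendsto_approx t.toNNReal x
    rw [Real.coe_toNNReal _ ht] at this
    exact this.sub_const x
  have h3 := ((R.continuous.tendsto _).comp h2).sub
    ((tendsto_one_div_add_atTop_nhds_zero_nat (𝕜 := ℝ)).smul h2)
  rw [zero_smul, sub_zero] at h3
  exact tendsto_nhds_unique h3 (h1.congr hint)

/-- The strongly continuous semigroup generated by the inverse of `R`
(see `IsDissipativeInverse.hasGenerator`). -/
def semigroup (h : IsDissipativeInverse R Q b) : C0Semigroup X where
  toFun := h.flow
  map_zero := ContinuousLinearMap.ext h.flow_zero
  map_add s t := ContinuousLinearMap.ext (h.flow_add s t)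
  tendsto_zero := by
    set M := √(‖Q‖ / b)
    have hM : 0 ≤ M := Real.sqrt_nonneg _
    have hR : ∀ y, Tendsto (fun t : ℝ≥0 => h.flow t (R y)) (𝓝 0) (𝓝 (R y)) := by
      intro y
      rw [tendsto_iff_norm_sub_tendsto_zero]
      have hlim : Tendsto (fun t : ℝ≥0 => M * ‖y‖ * |(t : ℝ) - 0|) (𝓝 0) (𝓝 0) := by
        have : Continuous fun t : ℝ≥0 => M * ‖y‖ * |(t : ℝ) - 0| := by fun_prop
        simpa using this.tendsto 0
      refine squeeze_zero (fun _ => norm_nonneg _) (fun t => ?_) hlim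
      have h1 := h.apply_flow_sub t.2 y
      rw [map_sub, h.apply_flow] at h1
      simp only [NNReal.val_eq_coe, Real.toNNReal_coe] at h1
      rw [h1]
      exact intervalIntegral.norm_integral_le_of_norm_le_const fun s _ => h.norm_flow_le _ _
    intro x
    rw [Metric.tendsto_nhds]
    intro e he
    obtain ⟨y, hy⟩ := h.denseRange.exists_dist_lt x (show 0 < e / (3 * (M + 1)) by positivity)
    rw [lt_div_iff₀ (by positivity)] at hy
    filter_upwards [Metric.tendsto_nhds.1 (hR y) (e / 3) (by positivity)] with t ht
    have h1 : dist (h.flow t x) (h.flow t (R y)) ≤ M * dist x (R y) := by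
      rw [dist_eq_norm, ← map_sub, dist_eq_norm]
      exact h.norm_flow_le t _
    have h2 := dist_triangle4_right (h.flow t x) x (h.flow t (R y)) (R y)
    nlinarith [dist_nonneg (x := x) (y := R y)]

theorem norm_semigroup_le (h : IsDissipativeInverse R Q b) (t : ℝ≥0) (x : X) :
    ‖h.semigroup.toFun t x‖ ≤ √(‖Q‖ / b) * ‖x‖ :=
  h.norm_flow_le t x

theorem apply_semigroup (h : IsDissipativeInverse R Q b) (t : ℝ≥0) (x : X) :
    R (h.semigroup.toFun t x) = h.semigroup.toFun t (R x) :=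
  h.apply_flow t x

theorem apply_semigroup_sub (h : IsDissipativeInverse R Q b) {t : ℝ} (ht : 0 ≤ t) (x : X) :
    R (h.semigroup.toFun t.toNNReal x - x)
      = ∫ s in (0 : ℝ)..t, h.semigroup.toFun s.toNNReal x :=
  h.apply_flow_sub ht x

theorem continuous_semigroup (h : IsDissipativeInverse R Q b) (x : X) :
    Continuous fun t : ℝ => h.semigroup.toFun t.toNNReal x := by
  suffices hc : Continuous fun t : ℝ≥0 => h.semigroup.toFun t x from
    hc.comp continuous_real_toNNReal
  set T := h.semigroup
  set M := √(‖Q‖ / b)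
  have hle : ∀ s t : ℝ≥0, s ≤ t → ‖T.toFun t x - T.toFun s x‖
      ≤ M * ‖T.toFun (nndist t s) x - x‖ := by
    intro s t hst
    have h1 : t = s + nndist t s := by
      apply NNReal.coe_injective
      rw [NNReal.coe_add, coe_nndist, NNReal.dist_eq, abs_of_nonneg]
      · ring
      · exact sub_nonneg.2 hst
    nth_rewrite 1 [h1]
    rw [T.map_add, ContinuousLinearMap.comp_apply, ← map_sub]
    exact h.norm_semigroup_le _ _
  refine continuous_iff_continuousAt.2 fun s => ?_
  rw [ContinuousAt, tendsto_iff_norm_sub_tendsto_zero]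
  have h1 : Tendsto (fun t : ℝ≥0 => nndist t s) (𝓝 s) (𝓝 0) := by
    have : Continuous fun t : ℝ≥0 => nndist t s := by fun_prop
    simpa using this.tendsto s
  have h2 := (((T.tendsto_zero x).comp h1).sub_const x).norm.const_mul M
  rw [sub_self, norm_zero, mul_zero] at h2
  refine squeeze_zero (fun _ => norm_nonneg _) (fun t => ?_) h2
  rcases le_total s t with hst | hst
  · exact hle s t hst
  · rw [norm_sub_rev, Function.comp_apply, nndist_comm]
    exact hle t s hst

/-- For `x = R y ∈ D(A)` the orbit is the primitive of the orbit of `y = A x`. -/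
theorem semigroup_apply_eq_add_integral (h : IsDissipativeInverse R Q b) {t : ℝ} (ht : 0 ≤ t)
    (y : X) :
    h.semigroup.toFun t.toNNReal (R y)
      = R y + ∫ s in (0 : ℝ)..t, h.semigroup.toFun s.toNNReal y := by
  rw [← h.apply_semigroup_sub ht, map_sub, h.apply_semigroup]
  abel

theorem hasDerivAt_integral_semigroup (h : IsDissipativeInverse R Q b) (y : X) (t : ℝ) :
    HasDerivAt (fun t : ℝ => R y + ∫ s in (0 : ℝ)..t, h.semigroup.toFun s.toNNReal y)
      (h.semigroup.toFun t.toNNReal y) t :=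
  ((h.continuous_semigroup y).integral_hasStrictDerivAt 0 t).hasDerivAt.const_add (R y)

/-- The semigroup is generated by the inverse of `R`. -/
theorem hasGenerator (h : IsDissipativeInverse R Q b) {A : X →ₗ.[ℝ] X}
    (hA : ∀ x y, (x, y) ∈ A.graph ↔ x = R y) : h.semigroup.HasGenerator A := by
  -- The difference quotient at `0+` of the primitive of an orbit.
  have hq : ∀ x, Tendsto (fun r : ℝ => r⁻¹ • ∫ s in (0 : ℝ)..r, h.semigroup.toFun s.toNNReal x)
      (𝓝[>] 0) (𝓝 x) := fun x => by
    have h1 := (h.hasDerivAt_integral_semigroup x 0).hasDerivWithinAt (s := Ioi 0)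
    rw [hasDerivWithinAt_iff_tendsto_slope' self_notMem_Ioi] at h1
    have h2 : h.semigroup.toFun (0 : ℝ).toNNReal x = x := by
      rw [Real.toNNReal_zero, h.semigroup.map_zero]; rfl
    rw [h2] at h1
    refine h1.congr fun r => ?_
    simp [slope_def_module]
  intro x y
  rw [hA]
  constructor
  · rintro rfl
    refine (hq y).congr' ?_
    filter_upwards [self_mem_nhdsWithin] with r (hr : 0 < r)
    rw [h.semigroup_apply_eq_add_integral hr.le, add_sub_cancel_left]
  · intro hy
    refine tendsto_nhds_unique (hq x) (((R.continuous.tendsto y).comp hy).congr' ?_)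
    filter_upwards [self_mem_nhdsWithin] with r (hr : 0 < r)
    rw [Function.comp_apply, map_smul, h.apply_semigroup_sub hr.le]

/-- Uniqueness of continuous solutions of the integrated equation `R (u(t) - u(0)) = ∫₀ᵗ u`. -/
theorem eq_semigroup_of_integral_eq (h : IsDissipativeInverse R Q b) {u : ℝ → X}
    (hu : ContinuousOn u (Ici 0))
    (hR : ∀ t, 0 ≤ t → R (u t - u 0) = ∫ s in (0 : ℝ)..t, u s) {t : ℝ} (ht : 0 ≤ t) :
    u t = h.semigroup.toFun t.toNNReal (u 0) := by
  set δ : ℝ → X := fun s => u (max s 0) - h.semigroup.toFun s.toNNReal (u 0)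
  have hu' : Continuous fun s => u (max s 0) :=
    continuousOn_univ.1 (hu.comp (by fun_prop) fun s _ => mem_Ici.2 (le_max_right s 0))
  have hδ : Continuous δ := hu'.sub (h.continuous_semigroup _)
  have hint : ∀ s, 0 ≤ s → R (δ s) = ∫ r in (0 : ℝ)..s, δ r := by
    intro s hs
    have h1 : ∫ r in (0 : ℝ)..s, u (max r 0) = ∫ r in (0 : ℝ)..s, u r :=
      intervalIntegral.integral_congr fun r hr => by
        rw [uIcc_of_le hs] at hr
        simp only [max_eq_left hr.1]
    rw [intervalIntegral.integral_sub (hu'.intervalIntegrable _ _)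
      ((h.continuous_semigroup _).intervalIntegrable _ _), h1, ← hR s hs,
      ← h.apply_semigroup_sub hs, ← map_sub]
    simp only [δ, max_eq_left hs]
    congr 1
    abel
  have hd : ∀ s, HasDerivAt (fun s => ∫ r in (0 : ℝ)..s, δ r) (δ s) s := fun s =>
    (hδ.integral_hasStrictDerivAt 0 s).hasDerivAt
  have h1 := le_add_mul_of_hasDerivAt_le (C := 0) (fun s => h.hasDerivAt_form (hd s))
    (fun s hs => by rw [← hint s hs]; linarith [h.nonpos (δ s)]) ht
  simp only [intervalIntegral.integral_same, map_zero, zero_mul, add_zero, ← hint t ht] at h1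
  have h2 := h.coercive (R (δ t))
  have h3 : ‖R (δ t)‖ ^ 2 ≤ 0 := by
    have hb := h.pos
    by_contra! hcon
    nlinarith
  have h4 : R (δ t) = 0 := by simpa using h3
  have h5 : δ t = 0 := h.injective (by rw [h4, map_zero])
  rw [← sub_eq_zero, ← h5]
  simp only [δ, max_eq_left ht]

/-! ### Exponential stability and observation of strictly dissipative semigroups -/

section Observation

variable {c : X →L[ℝ] ℝ} {ω : ℝ}

/-- Along orbits in the domain, `Q(u, u)` satisfies `(e^{ν t} Q(u, u))' ≤ 0` for
`ν = ω / (‖Q‖ + 1)`. -/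
theorem exponentiallyStable (h : IsDissipativeInverse R Q b) (hω : 0 < ω)
    (hs : ∀ y, 2 * Q (R y) y ≤ -(c y) ^ 2 - ω * ‖R y‖ ^ 2) :
    h.semigroup.ExponentiallyStable := by
  have hb := h.pos
  set ν : ℝ := ω / (‖Q‖ + 1)
  have hν : 0 < ν := by positivity
  have hνQ : ν * ‖Q‖ ≤ ω := by
    rw [div_mul_eq_mul_div, div_le_iff₀ (by positivity)]
    nlinarith [norm_nonneg Q]
  have hR : ∀ (t : ℝ≥0) (y : X), Real.exp (ν * t) *
      Q (h.semigroup.toFun t (R y)) (h.semigroup.toFun t (R y)) ≤ Q (R y) (R y) := by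
    intro t y
    have hd : ∀ s : ℝ, HasDerivAt (fun s : ℝ => Real.exp (ν * s)) (Real.exp (ν * s) * ν) s :=
      fun s => by simpa using ((hasDerivAt_id s).const_mul ν).exp
    have h1 := le_add_mul_of_hasDerivAt_le (C := 0)
      (fun s => (hd s).mul (h.hasDerivAt_form (h.hasDerivAt_integral_semigroup y s)))
      (fun s hs0 => ?_) t.2
    · simp only [Pi.mul_apply, mul_zero, Real.exp_zero, intervalIntegral.integral_same, add_zero,
        one_mul, zero_mul] at h1
      rw [← h.semigroup_apply_eq_add_integral t.2] at h1
      simpa using h1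
    · rw [← h.semigroup_apply_eq_add_integral hs0, ← h.apply_semigroup]
      set v := h.semigroup.toFun s.toNNReal y
      have h2 := hs v
      have h3 := apply_le Q (R v) (R v)
      have h4 : ν * Q (R v) (R v) + 2 * Q (R v) v ≤ 0 := by
        have h5 : ν * Q (R v) (R v) ≤ ω * ‖R v‖ ^ 2 := by
          calc _ ≤ ν * (‖Q‖ * ‖R v‖ * ‖R v‖) := by gcongr
            _ = (ν * ‖Q‖) * ‖R v‖ ^ 2 := by ring
            _ ≤ _ := by gcongr
        nlinarith [sq_nonneg (c v)]
      have h6 := mul_nonpos_of_nonneg_of_nonpos (Real.exp_pos (ν * s)).le h4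
      linarith
  have hX : ∀ (t : ℝ≥0) (x : X), Real.exp (ν * t) *
      Q (h.semigroup.toFun t x) (h.semigroup.toFun t x) ≤ Q x x := by
    intro t x
    refine h.denseRange.induction_on (p := fun x => Real.exp (ν * t) *
      Q (h.semigroup.toFun t x) (h.semigroup.toFun t x) ≤ Q x x) x ?_ (hR t)
    exact isClosed_le (by fun_prop) (by fun_prop)
  refine ⟨√(‖Q‖ / b), ν / 2, by positivity, fun t => ?_⟩
  refine ContinuousLinearMap.opNorm_le_bound _ (by positivity) fun x => ?_
  have h1 := hX t x
  have h2 := h.coercive (h.semigroup.toFun t x)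
  have h3 := apply_le Q x x
  have h4 : Real.exp (ν * t) = (Real.exp (-(ν / 2) * t))⁻¹ ^ 2 := by
    rw [← Real.exp_neg, ← Real.exp_nat_mul]
    congr 1
    push_cast
    ring
  set e := Real.exp (-(ν / 2) * t)
  have he : 0 < e := Real.exp_pos _
  rw [h4, inv_pow, inv_mul_le_iff₀ (by positivity)] at h1
  refine le_of_sq_le_sq ?_ (by positivity)
  rw [mul_pow, mul_pow, Real.sq_sqrt (by positivity), div_mul_eq_mul_div, div_mul_eq_mul_div,
    le_div_iff₀ hb]
  nlinarith [sq_nonneg e]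

theorem integral_sq_observation_le (h : IsDissipativeInverse R Q b) (hω : 0 < ω)
    (hs : ∀ y, 2 * Q (R y) y ≤ -(c y) ^ 2 - ω * ‖R y‖ ^ 2) {t : ℝ} (ht : 0 ≤ t) (y : X) :
    ∫ s in (0 : ℝ)..t, c (h.semigroup.toFun s.toNNReal y) ^ 2 ≤ ‖Q‖ * ‖R y‖ ^ 2 := by
  have hc : Continuous fun s : ℝ => c (h.semigroup.toFun s.toNNReal y) ^ 2 :=
    (c.continuous.comp (h.continuous_semigroup y)).pow 2
  have h1 := le_add_mul_of_hasDerivAt_le (C := 0)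
    (fun s => (h.hasDerivAt_form (h.hasDerivAt_integral_semigroup y s)).add
      (hc.integral_hasStrictDerivAt 0 s).hasDerivAt) (fun s hs0 => ?_) ht
  · simp only [Pi.add_apply, intervalIntegral.integral_same, add_zero, zero_mul] at h1
    rw [← h.semigroup_apply_eq_add_integral ht] at h1
    have h2 := h.coercive (h.semigroup.toFun t.toNNReal (R y))
    have h3 := apply_le Q (R y) (R y)
    have h4 : 0 ≤ b * ‖h.semigroup.toFun t.toNNReal (R y)‖ ^ 2 :=
      mul_nonneg h.pos.le (by positivity)
    nlinarith
  · rw [← h.semigroup_apply_eq_add_integral hs0, ← h.apply_semigroup]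
    have h2 := hs (h.semigroup.toFun s.toNNReal y)
    nlinarith [sq_nonneg ‖R (h.semigroup.toFun s.toNNReal y)‖]

theorem integrableOn_sq_observation (h : IsDissipativeInverse R Q b) (hω : 0 < ω)
    (hs : ∀ y, 2 * Q (R y) y ≤ -(c y) ^ 2 - ω * ‖R y‖ ^ 2) (y : X) :
    IntegrableOn (fun s : ℝ => c (h.semigroup.toFun s.toNNReal y) ^ 2) (Ioi 0) := by
  have hc : Continuous fun s : ℝ => c (h.semigroup.toFun s.toNNReal y) ^ 2 :=
    (c.continuous.comp (h.continuous_semigroup y)).pow 2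
  refine integrableOn_Ioi_of_intervalIntegral_norm_bounded (‖Q‖ * ‖R y‖ ^ 2) 0
    (l := atTop) (b := id) (fun _ => hc.integrableOn_Ioc) tendsto_id ?_
  filter_upwards [eventually_ge_atTop 0] with t ht
  simpa using h.integral_sq_observation_le hω hs ht y

theorem integral_Ioi_sq_observation_le (h : IsDissipativeInverse R Q b) (hω : 0 < ω)
    (hs : ∀ y, 2 * Q (R y) y ≤ -(c y) ^ 2 - ω * ‖R y‖ ^ 2) (y : X) :
    ∫ s in Ioi (0 : ℝ), c (h.semigroup.toFun s.toNNReal y) ^ 2 ≤ ‖Q‖ * ‖R y‖ ^ 2 := by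
  refine le_of_tendsto (intervalIntegral_tendsto_integral_Ioi 0
    (h.integrableOn_sq_observation hω hs y) tendsto_id) ?_
  filter_upwards [eventually_ge_atTop 0] with t ht
  exact h.integral_sq_observation_le hω hs ht y

theorem memLp_observation (h : IsDissipativeInverse R Q b) (hω : 0 < ω)
    (hs : ∀ y, 2 * Q (R y) y ≤ -(c y) ^ 2 - ω * ‖R y‖ ^ 2) (y : X) :
    MemLp (fun s : ℝ => c (h.semigroup.toFun s.toNNReal y)) 2 (volume.restrict (Ioi 0)) :=
  (memLp_two_iff_integrable_sq
    (c.continuous.comp (h.continuous_semigroup y)).aestronglyMeasurable).2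
    (h.integrableOn_sq_observation hω hs y)

/-- The output `t ↦ c (T(t) y) = C (T(t) x)` of the orbit of `x = R y`, for the observation
`C = c ∘ R⁻¹`. -/
def output (h : IsDissipativeInverse R Q b) (hω : 0 < ω)
    (hs : ∀ y, 2 * Q (R y) y ≤ -(c y) ^ 2 - ω * ‖R y‖ ^ 2) :
    X →ₗ[ℝ] Lp ℝ 2 (volume.restrict (Ioi (0 : ℝ))) where
  toFun y := (h.memLp_observation hω hs y).toLp
  map_add' y z := by
    rw [← MemLp.toLp_add]
    exact MemLp.toLp_congr _ _ (ae_of_all _ fun s => by simp)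
  map_smul' r y := by
    rw [RingHom.id_apply, ← MemLp.toLp_const_smul]
    exact MemLp.toLp_congr _ _ (ae_of_all _ fun s => by simp)

theorem norm_output_le (h : IsDissipativeInverse R Q b) (hω : 0 < ω)
    (hs : ∀ y, 2 * Q (R y) y ≤ -(c y) ^ 2 - ω * ‖R y‖ ^ 2) (y : X) :
    ‖h.output hω hs y‖ ≤ √‖Q‖ * ‖R y‖ := by
  have h1 : ‖h.output hω hs y‖ ^ 2
      = ∫ s in Ioi (0 : ℝ), c (h.semigroup.toFun s.toNNReal y) ^ 2 := by
    rw [← real_inner_self_eq_norm_sq, MeasureTheory.L2.inner_def]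
    refine integral_congr_ae ?_
    filter_upwards [(h.memLp_observation hω hs y).coeFn_toLp] with s hs1
    simp only [output, LinearMap.coe_mk, AddHom.coe_mk, hs1]
    simp [sq]
  refine le_of_sq_le_sq ?_ (by positivity)
  rw [h1, mul_pow, Real.sq_sqrt (norm_nonneg Q)]
  exact h.integral_Ioi_sq_observation_le hω hs y

/-- The continuous extension to all initial states of the output map `x ↦ C (T(·) x)`. -/
def outputExt (h : IsDissipativeInverse R Q b) (hω : 0 < ω)
    (hs : ∀ y, 2 * Q (R y) y ≤ -(c y) ^ 2 - ω * ‖R y‖ ^ 2) :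
    X →L[ℝ] Lp ℝ 2 (volume.restrict (Ioi (0 : ℝ))) :=
  (h.output hω hs).extendOfNorm (R : X →ₗ[ℝ] X)

/-- On the dense range of `R` the extended output is the output. -/
theorem outputExt_ae_eq (h : IsDissipativeInverse R Q b) (hω : 0 < ω)
    (hs : ∀ y, 2 * Q (R y) y ≤ -(c y) ^ 2 - ω * ‖R y‖ ^ 2) (y : X) :
    h.outputExt hω hs (R y) =ᵐ[volume.restrict (Ioi (0 : ℝ))]
      fun t => c (h.semigroup.toFun t.toNNReal y) := by
  have h1 : h.outputExt hω hs (R y) = h.output hω hs y :=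
    LinearMap.extendOfNorm_eq (e := (R : X →ₗ[ℝ] X)) h.denseRange
      ⟨_, h.norm_output_le hω hs⟩ y
  rw [h1]
  exact (h.memLp_observation hω hs y).coeFn_toLp

/-- The primitive of the extended output. For `x = R y` it is `∫₀ᵗ c (T(s) y) ds`, and both sides
are continuous in `x`. -/
theorem integral_outputExt (h : IsDissipativeInverse R Q b) (hω : 0 < ω)
    (hs : ∀ y, 2 * Q (R y) y ≤ -(c y) ^ 2 - ω * ‖R y‖ ^ 2) {t : ℝ} (ht : 0 ≤ t) (x : X) :
    ∫ s in (0 : ℝ)..t, h.outputExt hω hs x s = c (h.semigroup.toFun t.toNNReal x - x) := by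
  have hfin : (volume.restrict (Ioi (0 : ℝ))) (Ioc 0 t) ≠ ∞ :=
    ((Measure.restrict_apply_le _ _).trans_lt measure_Ioc_lt_top).ne
  have hsub : (volume.restrict (Ioi (0 : ℝ))).restrict (Ioc 0 t) = volume.restrict (Ioc 0 t) := by
    rw [Measure.restrict_restrict measurableSet_Ioc, inter_eq_left.2 Ioc_subset_Ioi_self]
  have h1 : ∀ g : Lp ℝ 2 (volume.restrict (Ioi (0 : ℝ))), ∫ s in (0 : ℝ)..t, g s
      = inner ℝ (indicatorConstLp 2 measurableSet_Ioc hfin (1 : ℝ)) g := fun g => by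
    rw [L2.inner_indicatorConstLp_one, hsub, intervalIntegral.integral_of_le ht]
  refine h.denseRange.induction_on (p := fun x => ∫ s in (0 : ℝ)..t, h.outputExt hω hs x s
    = c (h.semigroup.toFun t.toNNReal x - x)) x ?_ fun y => ?_
  · simp only [h1]
    exact isClosed_eq (by fun_prop) (by fun_prop)
  · have h2 : ∫ s in (0 : ℝ)..t, h.outputExt hω hs (R y) s
        = ∫ s in (0 : ℝ)..t, c (h.semigroup.toFun s.toNNReal y) := by
      rw [intervalIntegral.integral_of_le ht, intervalIntegral.integral_of_le ht, ← hsub]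
      exact integral_congr_ae (ae_restrict_of_ae (h.outputExt_ae_eq hω hs y))
    rw [h2, c.intervalIntegral_comp_comm ((h.continuous_semigroup y).intervalIntegrable _ _),
      h.semigroup_apply_eq_add_integral ht, add_sub_cancel_left]

theorem exists_lintegral_observation_le (h : IsDissipativeInverse R Q b) (hω : 0 < ω)
    (hs : ∀ y, 2 * Q (R y) y ≤ -(c y) ^ 2 - ω * ‖R y‖ ^ 2) (t : ℝ) : ∃ K : ℝ≥0, ∀ y,
      ∫⁻ s in Ioc 0 t, ‖c (h.semigroup.toFun s.toNNReal y)‖ₑ ^ 2 ≤ K * ‖R y‖ₑ ^ 2 := by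
  refine ⟨‖Q‖₊, fun y => ?_⟩
  have h1 : ∀ r : ℝ, ‖r‖ₑ ^ 2 = ENNReal.ofReal (r ^ 2) := fun r => by
    rw [← sq_abs, ENNReal.ofReal_pow (abs_nonneg r), ← Real.norm_eq_abs, ofReal_norm]
  calc ∫⁻ s in Ioc 0 t, ‖c (h.semigroup.toFun s.toNNReal y)‖ₑ ^ 2
      ≤ ∫⁻ s in Ioi (0 : ℝ), ‖c (h.semigroup.toFun s.toNNReal y)‖ₑ ^ 2 :=
        lintegral_mono_set (s := Ioc 0 t) (t := Ioi 0) Ioc_subset_Ioi_self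
    _ = ENNReal.ofReal (∫ s in Ioi (0 : ℝ), c (h.semigroup.toFun s.toNNReal y) ^ 2) := by
        rw [ofReal_integral_eq_lintegral_ofReal (h.integrableOn_sq_observation hω hs y)
          (ae_of_all _ fun s => sq_nonneg _)]
        simp only [h1]
    _ ≤ ENNReal.ofReal (‖Q‖ * ‖R y‖ ^ 2) :=
        ENNReal.ofReal_le_ofReal (h.integral_Ioi_sq_observation_le hω hs y)
    _ = ‖Q‖₊ * ‖R y‖ₑ ^ 2 := by
        rw [ENNReal.ofReal_mul (norm_nonneg Q), ENNReal.ofReal_pow (norm_nonneg (R y)),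
          ofReal_norm, ofReal_norm, enorm_eq_nnnorm Q]

end Observation

end IsDissipativeInverse

end WaveEstimator

namespace WaveEstimator

/-! ### Bounded operators and integration by parts in `H¹(0,1)` -/

namespace H1

/-- The element of `H¹(0,1)` with value `a` at `0` and derivative `g`. -/
def mk (a : ℝ) (g : L2) : H1 := WithLp.toLp 2 (a, g)

theorem eval_zero_mk (a : ℝ) (g : L2) : (mk a g).eval 0 = a := eval_left _

theorem deriv_mk (a : ℝ) (g : L2) : (mk a g).deriv = g := rfl

theorem mk_eval_zero_deriv (φ : H1) : mk (φ.eval 0) φ.deriv = φ := by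
  rw [eval_left]; rfl

/-- `H1.mk` as a continuous linear map. -/
def mkL : ℝ × L2 →L[ℝ] H1 := ((WithLp.prodContinuousLinearEquiv 2 ℝ ℝ L2).symm : ℝ × L2 →L[ℝ] H1)

/-- The derivative as a continuous linear map. -/
def derivL : H1 →L[ℝ] L2 :=
  (ContinuousLinearMap.snd ℝ ℝ L2).comp
    (WithLp.prodContinuousLinearEquiv 2 ℝ ℝ L2 : H1 →L[ℝ] ℝ × L2)

theorem derivL_apply (φ : H1) : derivL φ = φ.deriv := rfl

/-- The value at `0` as a continuous linear functional. -/
def evalZeroL : H1 →L[ℝ] ℝ :=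
  (ContinuousLinearMap.fst ℝ ℝ L2).comp
    (WithLp.prodContinuousLinearEquiv 2 ℝ ℝ L2 : H1 →L[ℝ] ℝ × L2)

theorem evalZeroL_apply (φ : H1) : evalZeroL φ = φ.eval 0 := (eval_left φ).symm

theorem restrict_Ioo_ne_top (x : ℝ) : volume.restrict (Ioo (0 : ℝ) 1) (Ioo 0 x) ≠ ∞ :=
  ((Measure.restrict_apply_le _ _).trans_lt measure_Ioo_lt_top).ne

theorem eval_eq_add_inner (φ : H1) {x : ℝ} (hx : x ∈ Icc (0 : ℝ) 1) :
    φ.eval x = φ.eval 0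
      + inner ℝ (indicatorConstLp 2 measurableSet_Ioo (restrict_Ioo_ne_top x) (1 : ℝ)) φ.deriv := by
  rw [L2.inner_indicatorConstLp_one, Measure.restrict_restrict measurableSet_Ioo,
    inter_eq_left.2 (Ioo_subset_Ioo_right hx.2), eval_left, eval,
    intervalIntegral.integral_of_le hx.1, integral_Ioc_eq_integral_Ioo]

theorem norm_indicator_le (x : ℝ) :
    ‖indicatorConstLp 2 measurableSet_Ioo (restrict_Ioo_ne_top x) (1 : ℝ)‖ ≤ 1 := by
  refine norm_indicatorConstLp_le.trans ?_
  rw [norm_one, one_mul]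
  refine Real.rpow_le_one measureReal_nonneg ?_ (by positivity)
  have h1 := measureReal_mono (μ := volume.restrict (Ioo (0 : ℝ) 1)) (subset_univ (Ioo 0 x))
  simpa using h1

theorem abs_eval_le (φ : H1) {x : ℝ} (hx : x ∈ Icc (0 : ℝ) 1) :
    |φ.eval x| ≤ |φ.eval 0| + ‖φ.deriv‖ := by
  rw [eval_eq_add_inner φ hx]
  refine (abs_add_le _ _).trans (add_le_add le_rfl ((abs_real_inner_le_norm _ _).trans ?_))
  exact (mul_le_mul_of_nonneg_right (norm_indicator_le x) (norm_nonneg _)).trans_eq (one_mul _)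

/-- The constant function `1` in `L²(0,1)`. -/
def constOne : L2 := indicatorConstLp 2 measurableSet_Ioo (restrict_Ioo_ne_top 1) (1 : ℝ)

theorem eval_one_eq (φ : H1) : φ.eval 1 = φ.eval 0 + inner ℝ constOne φ.deriv :=
  eval_eq_add_inner φ (right_mem_Icc.2 zero_le_one)

theorem inner_constOne_self : inner ℝ constOne constOne = (1 : ℝ) := by
  rw [constOne, L2.inner_indicatorConstLp_one, setIntegral_indicatorConstLp measurableSet_Ioo]
  simp

/-- The value at `1` as a continuous linear functional. -/
def evalOneL : H1 →L[ℝ] ℝ := evalZeroL + (innerSL ℝ constOne).comp derivL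

theorem evalOneL_apply (φ : H1) : evalOneL φ = φ.eval 1 := by
  rw [eval_one_eq]
  simp [evalOneL, evalZeroL_apply, derivL_apply]

theorem norm_sq_eq (φ : H1) : ‖φ‖ ^ 2 = φ.eval 0 ^ 2 + ‖φ.deriv‖ ^ 2 := by
  rw [WithLp.prod_norm_sq_eq_of_L2, eval_left, Real.norm_eq_abs, sq_abs]
  rfl

/-- The inclusion of `H¹(0,1)` in `L²(0,1)` as a continuous linear map. -/
def toL2L : H1 →L[ℝ] L2 :=
  toL2.mkContinuous 2 fun φ => by
    have h1 : ∀ᵐ x ∂(volume.restrict (Ioo (0 : ℝ) 1)),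
        ‖toL2 φ x‖ ≤ |φ.eval 0| + ‖φ.deriv‖ := by
      filter_upwards [coeFn_toL2 φ, self_mem_ae_restrict measurableSet_Ioo] with x hx hx1
      rw [hx]
      exact abs_eval_le φ (Ioo_subset_Icc_self hx1)
    have h2 := Lp.norm_le_of_ae_bound (by positivity) h1
    have h3 : measureUnivNNReal (volume.restrict (Ioo (0 : ℝ) 1)) = 1 := by
      simp [measureUnivNNReal]
    rw [h3, NNReal.coe_one, Real.one_rpow, one_mul] at h2
    have h4 := norm_sq_eq φ
    have h5 : |φ.eval 0| ≤ ‖φ‖ := abs_le_of_sq_le_sq (by nlinarith) (norm_nonneg _)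
    have h6 : ‖φ.deriv‖ ≤ ‖φ‖ := le_of_sq_le_sq (by nlinarith) (norm_nonneg _)
    linarith

theorem ae_deriv_eval (φ : H1) :
    ∀ᵐ x ∂(volume.restrict (Ioo (0 : ℝ) 1)), _root_.deriv (eval φ) x = deriv φ x :=
  (ae_hasDerivAt_eval φ).mono fun _ hx => hx.deriv

/-- Integration by parts. -/
theorem inner_deriv_add_inner (φ η : H1) :
    inner ℝ φ.deriv (toL2 η) + inner ℝ (toL2 φ) η.deriv
      = φ.eval 1 * η.eval 1 - φ.eval 0 * η.eval 0 := by
  rw [← (absolutelyContinuousOnInterval_eval φ).integral_deriv_mul_eq_sub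
    (absolutelyContinuousOnInterval_eval η), L2.inner_def, L2.inner_def, ← integral_add,
    intervalIntegral.integral_of_le zero_le_one, integral_Ioc_eq_integral_Ioo]
  · refine integral_congr_ae ?_
    filter_upwards [coeFn_toL2 φ, coeFn_toL2 η, ae_deriv_eval φ, ae_deriv_eval η] with x h1 h2 h3 h4
    rw [h1, h2, h3, h4]
    simp [mul_comm]
  · exact L2.integrable_inner _ _
  · exact L2.integrable_inner _ _

/-- The element `1 - x` of `H¹(0,1)`. -/
def hat : H1 := mk 1 (-constOne)

/-- Taylor's formula `0 = φ(1) = φ(0) + φ'(0) + ∫₀¹ (1 - x) φ''(x) dx` for `φ ∈ H²(0,1)` with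
derivative `s`. -/
theorem inner_hat_deriv (s φ : H1) (hs : φ.deriv = toL2 s) (hφ : φ.eval 1 = 0) :
    inner ℝ (toL2 hat) s.deriv = -φ.eval 0 - s.eval 0 := by
  have h1 := inner_deriv_add_inner hat s
  have h2 : hat.eval 0 = 1 := eval_zero_mk _ _
  have h3 : hat.eval 1 = 0 := by
    rw [eval_one_eq, h2, hat, deriv_mk, inner_neg_right, inner_constOne_self, add_neg_cancel]
  rw [h2, h3, hat, deriv_mk, ← hat, inner_neg_left, ← hs] at h1
  rw [eval_one_eq] at hφ
  linarith

theorem memLp_weight (g : L2) :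
    MemLp (fun x => (x - 2) * g x) 2 (volume.restrict (Ioo (0 : ℝ) 1)) := by
  refine (Lp.memLp g).of_le_mul (c := 2)
    ((by fun_prop : Continuous fun x : ℝ => x - 2).aestronglyMeasurable.mul
      (Lp.memLp g).aestronglyMeasurable) ?_
  filter_upwards [self_mem_ae_restrict measurableSet_Ioo] with x hx
  rw [norm_mul]
  gcongr
  rw [Real.norm_eq_abs, abs_le]
  constructor <;> linarith [hx.1, hx.2]

/-- Multiplication by the weight `x - 2` in `L²(0,1)`. -/
def weight : L2 →L[ℝ] L2 :=
  LinearMap.mkContinuous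
    { toFun := fun g => (memLp_weight g).toLp
      map_add' := fun g h => by
        rw [← MemLp.toLp_add]
        refine MemLp.toLp_congr _ _ ?_
        filter_upwards [Lp.coeFn_add g h] with x hx
        simp only [hx, Pi.add_apply]
        ring
      map_smul' := fun r g => by
        rw [RingHom.id_apply, ← MemLp.toLp_const_smul]
        refine MemLp.toLp_congr _ _ ?_
        filter_upwards [Lp.coeFn_smul r g] with x hx
        simp only [hx, Pi.smul_apply, smul_eq_mul]
        ring } 2 fun g => by
    refine Lp.norm_le_mul_norm_of_ae_le_mul ?_
    filter_upwards [(memLp_weight g).coeFn_toLp, self_mem_ae_restrict measurableSet_Ioo]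
      with x hx hx1
    simp only [LinearMap.coe_mk, AddHom.coe_mk, hx, norm_mul]
    gcongr
    rw [Real.norm_eq_abs, abs_le]
    constructor <;> linarith [hx1.1, hx1.2]

theorem coeFn_weight (g : L2) :
    weight g =ᵐ[volume.restrict (Ioo (0 : ℝ) 1)] fun x => (x - 2) * g x :=
  (memLp_weight g).coeFn_toLp

theorem norm_weight_le (g : L2) : ‖weight g‖ ≤ 2 * ‖g‖ := by
  refine Lp.norm_le_mul_norm_of_ae_le_mul ?_
  filter_upwards [coeFn_weight g, self_mem_ae_restrict measurableSet_Ioo] with x hx hx1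
  rw [hx, norm_mul]
  gcongr
  rw [Real.norm_eq_abs, abs_le]
  constructor <;> linarith [hx1.1, hx1.2]

theorem inner_weight_comm (g h : L2) : inner ℝ (weight g) h = inner ℝ (weight h) g := by
  rw [L2.inner_def, L2.inner_def]
  refine integral_congr_ae ?_
  filter_upwards [coeFn_weight g, coeFn_weight h] with x h1 h2
  rw [h1, h2]
  simp
  ring

/-- The multiplier identity `2 ∫ (x - 2) h h' = 2 h(0)² - h(1)² - ∫ h²`. -/
theorem two_mul_inner_weight (h : H1) :
    2 * inner ℝ (weight (toL2 h)) h.deriv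
      = 2 * h.eval 0 ^ 2 - h.eval 1 ^ 2 - ‖toL2 h‖ ^ 2 := by
  have hw : ContDiff ℝ 1 fun x : ℝ => x - 2 := by fun_prop
  have h1 := ((hw.contDiffOn.absolutelyContinuousOnInterval).fun_mul
    (absolutelyContinuousOnInterval_eval h)).integral_deriv_mul_eq_sub
    (absolutelyContinuousOnInterval_eval h) (a := 0) (b := 1)
  have h2 : ∫ x in (0 : ℝ)..1, (_root_.deriv (fun x => (x - 2) * eval h x) x * eval h x
      + (x - 2) * eval h x * _root_.deriv (eval h) x)
      = ‖toL2 h‖ ^ 2 + 2 * inner ℝ (weight (toL2 h)) h.deriv := by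
    rw [intervalIntegral.integral_of_le zero_le_one, integral_Ioc_eq_integral_Ioo,
      ← real_inner_self_eq_norm_sq, L2.inner_def, L2.inner_def, ← integral_const_mul,
      ← integral_add (L2.integrable_inner _ _) ((L2.integrable_inner _ _).const_mul 2)]
    refine integral_congr_ae ?_
    filter_upwards [coeFn_toL2 h, ae_hasDerivAt_eval h, coeFn_weight (toL2 h)] with x h3 h4 h5
    have h6 := ((hasDerivAt_id x).sub_const 2).mul h4
    have h7 : _root_.deriv (fun x => (x - 2) * eval h x) x = 1 * eval h x + (x - 2) * deriv h x :=
      h6.deriv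
    rw [h7, h4.deriv, h5, h3]
    simp
    ring
  rw [h2] at h1
  linarith

/-- An element of `L²(0,1)` orthogonal to the derivatives of all `η ∈ H¹(0,1)` with `η(1) = 0`
is zero. -/
theorem eq_zero_of_inner_deriv {g : L2}
    (hg : ∀ η : H1, η.eval 1 = 0 → inner ℝ g η.deriv = 0) : g = 0 := by
  have h1 := hg (mk (-inner ℝ constOne g) g) (by
    rw [eval_one_eq, eval_zero_mk, deriv_mk, neg_add_cancel])
  rw [deriv_mk] at h1
  exact inner_self_eq_zero.1 h1

end H1

/-! ### The state spaces -/

/-- The displacement as a continuous linear map. -/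
def dispL : Energy →L[ℝ] H1 :=
  (ContinuousLinearMap.fst ℝ H1 L2).comp
    (WithLp.prodContinuousLinearEquiv 2 ℝ H1 L2 : Energy →L[ℝ] H1 × L2)

/-- The velocity as a continuous linear map. -/
def velL : Energy →L[ℝ] L2 :=
  (ContinuousLinearMap.snd ℝ H1 L2).comp
    (WithLp.prodContinuousLinearEquiv 2 ℝ H1 L2 : Energy →L[ℝ] H1 × L2)

theorem disp_sub (x y : Energy) : disp (x - y) = disp x - disp y := rfl

theorem vel_sub (x y : Energy) : vel (x - y) = vel x - vel y := rfl

theorem state_ext {x y : Energy} (h1 : disp x = disp y) (h2 : vel x = vel y) : x = y :=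
  (WithLp.ofLp_injective 2) (Prod.ext h1 h2)

theorem norm_sq_eq_add (x : Energy) :
    ‖x‖ ^ 2 = (disp x).eval 0 ^ 2 + ‖(disp x).deriv‖ ^ 2 + ‖vel x‖ ^ 2 := by
  rw [WithLp.prod_norm_sq_eq_of_L2, ← H1.norm_sq_eq]
  rfl

theorem isClosed_energy0 : IsClosed (Energy0 : Set Energy) := by
  have h1 : (Energy0 : Set Energy) = (H1.evalOneL.comp dispL) ⁻¹' {0} := by
    ext x
    simp only [mem_preimage, ContinuousLinearMap.comp_apply, H1.evalOneL_apply]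
    rfl
  rw [h1]
  exact isClosed_singleton.preimage (ContinuousLinearMap.continuous _)

instance completeSpace_energy0 : CompleteSpace Energy0 :=
  isClosed_energy0.completeSpace_coe

/-- The displacement on the subspace `Energy0`. -/
def disp₀ : Energy0 →L[ℝ] H1 := dispL.comp Energy0.subtypeL

/-- The velocity on the subspace `Energy0`. -/
def vel₀ : Energy0 →L[ℝ] L2 := velL.comp Energy0.subtypeL

theorem disp₀_apply (x : Energy0) : disp₀ x = disp x := rfl

theorem vel₀_apply (x : Energy0) : vel₀ x = vel x := rfl

theorem eval_one_disp₀ (x : Energy0) : (disp₀ x).eval 1 = 0 := x.2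

/-! ### The generator and its inverse -/

/-- The graph of the generator, with `s` the `H¹` representative of `φ'`; that `ψ(1) = 0` is part of
`y ∈ Energy0`. -/
theorem mem_graph_waveGenerator {k₁ k₀ : ℝ} {x y : Energy0} :
    (x, y) ∈ (waveGenerator k₁ k₀).graph ↔ ∃ s : H1, H1.toL2 s = (disp₀ x).deriv ∧
      H1.toL2 (disp₀ y) = vel₀ x ∧ s.deriv = vel₀ y ∧
      s.eval 0 = k₁ * (disp₀ x).eval 0 + k₀ * (disp₀ y).eval 0 := by
  rw [LinearPMap.mem_graph_iff]
  constructor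
  · rintro ⟨x, rfl, rfl⟩
    exact ⟨slope (waveDomainIncl k₁ k₀ x), toL2_slope _, toL2_speed _, rfl, x.2.2.2⟩
  · rintro ⟨s, h1, h2, h3, h4⟩
    have hreg : x ∈ regular := ⟨⟨s, h1⟩, ⟨disp₀ y, h2⟩⟩
    have hs : slope ⟨x, hreg⟩ = s := H1.toL2_injective ((toL2_slope _).trans h1.symm)
    have hv : speed ⟨x, hreg⟩ = disp₀ y := H1.toL2_injective ((toL2_speed _).trans h2.symm)
    refine ⟨⟨x, hreg, ?_, ?_⟩, rfl, ?_⟩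
    · rw [hv]; exact y.2
    · rw [hv, hs]; exact h4
    · refine Subtype.ext (state_ext hv ?_)
      exact (congrArg H1.deriv hs).trans h3

theorem neumannObservation_eq {k₁ k₀ : ℝ} (x : (waveGenerator k₁ k₀).domain) {s : H1}
    (hs : H1.toL2 s = (disp₀ x).deriv) : neumannObservation k₁ k₀ x = s.eval 1 := by
  have h1 : slope (waveDomainIncl k₁ k₀ x) = s :=
    H1.toL2_injective ((toL2_slope _).trans hs.symm)
  change (slope (waveDomainIncl k₁ k₀ x)).eval 1 = _
  rw [h1]

section Inverse

variable (k₁ k₀ : ℝ)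

/-- For `x = A⁻¹ y`, `x = (φ, ψ)`, the value `φ(0)`. It is determined by `φ(1) = 0`, that is
`φ(0) + φ'(0) + ∫₀¹ (1 - r) φ''(r) dr = 0`, and the boundary condition at `0`. -/
def inverseTrace : Energy0 →L[ℝ] ℝ :=
  -(1 + k₁)⁻¹ • (k₀ • H1.evalZeroL.comp disp₀ + (innerSL ℝ (H1.toL2 H1.hat)).comp vel₀)

/-- For `x = A⁻¹ y`, `x = (φ, ψ)`, the function `φ' ∈ H¹(0,1)`. -/
def inverseSlope : Energy0 →L[ℝ] H1 :=
  H1.mkL.comp ((k₁ • inverseTrace k₁ k₀ + k₀ • H1.evalZeroL.comp disp₀).prod vel₀)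

theorem deriv_inverseSlope (y : Energy0) : (inverseSlope k₁ k₀ y).deriv = vel₀ y := rfl

theorem eval_zero_inverseSlope (y : Energy0) : (inverseSlope k₁ k₀ y).eval 0
    = k₁ * inverseTrace k₁ k₀ y + k₀ * (disp₀ y).eval 0 := by
  change (H1.mk _ _).eval 0 = _
  rw [H1.eval_zero_mk, ← H1.evalZeroL_apply]
  rfl

/-- The displacement `φ` of `A⁻¹ y`. -/
def inverseDisp : Energy0 →L[ℝ] H1 :=
  H1.mkL.comp ((inverseTrace k₁ k₀).prod (H1.toL2L.comp (inverseSlope k₁ k₀)))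

theorem eval_zero_inverseDisp (y : Energy0) :
    (inverseDisp k₁ k₀ y).eval 0 = inverseTrace k₁ k₀ y := H1.eval_zero_mk _ _

theorem deriv_inverseDisp (y : Energy0) :
    (inverseDisp k₁ k₀ y).deriv = H1.toL2 (inverseSlope k₁ k₀ y) := rfl

variable {k₁ k₀}

theorem inverseTrace_spec (hk₁ : 0 < k₁) (y : Energy0) : (1 + k₁) * inverseTrace k₁ k₀ y
    = -(k₀ * (disp₀ y).eval 0 + inner ℝ (H1.toL2 H1.hat) (vel₀ y)) := by
  have h1 : inverseTrace k₁ k₀ y = -(1 + k₁)⁻¹ *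
      (k₀ * (disp₀ y).eval 0 + inner ℝ (H1.toL2 H1.hat) (vel₀ y)) := by
    rw [← H1.evalZeroL_apply]; rfl
  rw [h1]
  field_simp

theorem eval_one_inverseDisp (hk₁ : 0 < k₁) (y : Energy0) :
    (inverseDisp k₁ k₀ y).eval 1 = 0 := by
  set φ := inverseDisp k₁ k₀ y
  -- Subtract from `φ` its value at `1` to apply the formula for functions vanishing there.
  have h1 := H1.inner_hat_deriv (inverseSlope k₁ k₀ y)
    (H1.mk (φ.eval 0 - φ.eval 1) φ.deriv) (deriv_inverseDisp k₁ k₀ y) (by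
      have h2 := H1.eval_one_eq φ
      rw [H1.eval_one_eq, H1.eval_zero_mk, H1.deriv_mk]
      linarith)
  rw [H1.eval_zero_mk, eval_zero_inverseSlope, deriv_inverseSlope, eval_zero_inverseDisp] at h1
  linarith [inverseTrace_spec (k₀ := k₀) hk₁ y]

variable (k₀) in
/-- The bounded inverse of the generator. -/
def inverse (hk₁ : 0 < k₁) : Energy0 →L[ℝ] Energy0 :=
  (((WithLp.prodContinuousLinearEquiv 2 ℝ H1 L2).symm : H1 × L2 →L[ℝ] Energy).comp
    ((inverseDisp k₁ k₀).prod (H1.toL2L.comp disp₀))).codRestrict Energy0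
    fun y => eval_one_inverseDisp hk₁ y

theorem disp₀_inverse (hk₁ : 0 < k₁) (y : Energy0) :
    disp₀ (inverse k₀ hk₁ y) = inverseDisp k₁ k₀ y := rfl

theorem vel₀_inverse (hk₁ : 0 < k₁) (y : Energy0) :
    vel₀ (inverse k₀ hk₁ y) = H1.toL2 (disp₀ y) := rfl

theorem mem_graph_iff_eq_inverse (hk₁ : 0 < k₁) (x y : Energy0) :
    (x, y) ∈ (waveGenerator k₁ k₀).graph ↔ x = inverse k₀ hk₁ y := by
  rw [mem_graph_waveGenerator]
  constructor
  · rintro ⟨s, h1, h2, h3, h4⟩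
    have h5 := H1.inner_hat_deriv s (disp₀ x) h1.symm (eval_one_disp₀ x)
    have h6 := inverseTrace_spec (k₀ := k₀) hk₁ y
    rw [h3, h4] at h5
    have h7 : (disp₀ x).eval 0 = inverseTrace k₁ k₀ y := by
      have h8 : (1 + k₁) * (disp₀ x).eval 0 = (1 + k₁) * inverseTrace k₁ k₀ y := by linarith
      exact mul_left_cancel₀ (by positivity) h8
    have h8 : s = inverseSlope k₁ k₀ y := by
      rw [← H1.mk_eval_zero_deriv s, ← H1.mk_eval_zero_deriv (inverseSlope k₁ k₀ y), h4, h3, h7,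
        eval_zero_inverseSlope, deriv_inverseSlope]
    refine Subtype.ext (state_ext ?_ h2.symm)
    change disp₀ x = inverseDisp k₁ k₀ y
    rw [← H1.mk_eval_zero_deriv (disp₀ x), ← H1.mk_eval_zero_deriv (inverseDisp k₁ k₀ y), h7,
      eval_zero_inverseDisp, ← h1, h8, deriv_inverseDisp]
  · rintro rfl
    refine ⟨inverseSlope k₁ k₀ y, rfl, rfl, rfl, ?_⟩
    rw [eval_zero_inverseSlope, disp₀_inverse, eval_zero_inverseDisp]

end Inverse

/-! ### The Lyapunov functional -/

section Lyapunov

variable {k₁ k₀ : ℝ}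

/-- The bilinear form
`Q = N (∫ (φ'φ̃' + ψψ̃) + k₁ φ(0)φ̃(0)) + ∫ (x - 2) (φ'ψ̃ + φ̃'ψ)`
`  + γ (φ(0) ∫ (1 - x) ψ̃ + φ̃(0) ∫ (1 - x) ψ + k₀ φ(0)φ̃(0))`:
the energy, perturbed by the multiplier `x - 2`, which makes it decay and controls the Neumann
trace at `1`, and by a term which makes up for the missing dissipation of `φ(0)²`. -/
def lyapunov (k₁ k₀ N γ : ℝ) : Energy0 →L[ℝ] Energy0 →L[ℝ] ℝ :=
  let D : Energy0 →L[ℝ] L2 := H1.derivL.comp disp₀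
  let a : Energy0 →L[ℝ] ℝ := H1.evalZeroL.comp disp₀
  let l : Energy0 →L[ℝ] ℝ := (innerSL ℝ (H1.toL2 H1.hat)).comp vel₀
  N • ((innerSL ℝ).bilinearComp D D + (innerSL ℝ).bilinearComp vel₀ vel₀
    + k₁ • (innerSL ℝ).bilinearComp a a)
  + ((innerSL ℝ).bilinearComp (H1.weight.comp D) vel₀
    + (innerSL ℝ).bilinearComp (H1.weight.comp vel₀) D)
  + γ • ((innerSL ℝ).bilinearComp a l + (innerSL ℝ).bilinearComp l a
    + k₀ • (innerSL ℝ).bilinearComp a a)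

theorem lyapunov_apply (k₁ k₀ N γ : ℝ) (x y : Energy0) : lyapunov k₁ k₀ N γ x y
    = N * (inner ℝ (disp₀ x).deriv (disp₀ y).deriv + inner ℝ (vel₀ x) (vel₀ y)
        + k₁ * ((disp₀ x).eval 0 * (disp₀ y).eval 0))
      + (inner ℝ (H1.weight (disp₀ x).deriv) (vel₀ y)
        + inner ℝ (H1.weight (vel₀ x)) (disp₀ y).deriv)
      + γ * ((disp₀ x).eval 0 * inner ℝ (H1.toL2 H1.hat) (vel₀ y)
        + inner ℝ (H1.toL2 H1.hat) (vel₀ x) * (disp₀ y).eval 0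
        + k₀ * ((disp₀ x).eval 0 * (disp₀ y).eval 0)) := by
  simp only [lyapunov, add_apply, smul_apply, ContinuousLinearMap.bilinearComp_apply,
    innerSL_apply_apply, ContinuousLinearMap.comp_apply, smul_eq_mul, H1.evalZeroL_apply,
    H1.derivL_apply, RCLike.inner_apply, conj_trivial]
  ring

/-- The derivative of the Lyapunov functional along the flow, in terms of boundary values. -/
theorem two_mul_lyapunov_inverse (hk₁ : 0 < k₁) (N γ : ℝ) (y : Energy0) :
    2 * lyapunov k₁ k₀ N γ (inverse k₀ hk₁ y) y
      = -2 * N * k₀ * (disp₀ y).eval 0 ^ 2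
        + (2 * (inverseSlope k₁ k₀ y).eval 0 ^ 2 - (inverseSlope k₁ k₀ y).eval 1 ^ 2
          - ‖H1.toL2 (inverseSlope k₁ k₀ y)‖ ^ 2)
        + (2 * (disp₀ y).eval 0 ^ 2 - ‖H1.toL2 (disp₀ y)‖ ^ 2)
        + 2 * γ * (inner ℝ (H1.toL2 H1.hat) (H1.toL2 (disp₀ y)) * (disp₀ y).eval 0
          - (1 + k₁) * (inverseDisp k₁ k₀ y).eval 0 ^ 2) := by
  have h1 := H1.inner_deriv_add_inner (disp₀ y) (inverseSlope k₁ k₀ y)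
  have h2 := H1.two_mul_inner_weight (inverseSlope k₁ k₀ y)
  have h3 := H1.two_mul_inner_weight (disp₀ y)
  have h4 := H1.inner_hat_deriv (inverseSlope k₁ k₀ y) (inverseDisp k₁ k₀ y) rfl
    (eval_one_inverseDisp hk₁ y)
  have h5 := eval_zero_inverseSlope k₁ k₀ y
  rw [← eval_zero_inverseDisp] at h5
  rw [eval_one_disp₀] at h1 h3
  rw [lyapunov_apply, disp₀_inverse, vel₀_inverse, deriv_inverseDisp]
  rw [deriv_inverseSlope] at h1 h2 h4
  rw [h4, real_inner_comm]
  rw [h5] at h1 ⊢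
  rw [h5] at h2
  linear_combination 2 * N * h1 + h2 + h3

theorem abs_inner_hat_le (g : L2) :
    |inner ℝ (H1.toL2 H1.hat) g| ≤ ‖H1.toL2 H1.hat‖ * ‖g‖ :=
  abs_real_inner_le_norm _ _

theorem two_mul_lyapunov_inverse_le (hk₁ : 0 < k₁) {N γ : ℝ} (hγ : 0 < γ)
    (hγ₁ : 4 * k₁ ^ 2 + 1 / 2 ≤ 2 * γ * (1 + k₁))
    (hN : 2 + 4 * k₀ ^ 2 + 2 * γ ^ 2 * ‖H1.toL2 H1.hat‖ ^ 2 ≤ N * (2 * k₀)) (y : Energy0) :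
    2 * lyapunov k₁ k₀ N γ (inverse k₀ hk₁ y) y
      ≤ -((H1.evalOneL.comp (inverseSlope k₁ k₀)) y) ^ 2 - 1 / 2 * ‖inverse k₀ hk₁ y‖ ^ 2 := by
  rw [two_mul_lyapunov_inverse, ContinuousLinearMap.comp_apply, H1.evalOneL_apply,
    Submodule.coe_norm, norm_sq_eq_add, ← disp₀_apply, ← vel₀_apply, disp₀_inverse,
    vel₀_inverse, deriv_inverseDisp, eval_zero_inverseSlope, ← eval_zero_inverseDisp]
  have h1 := abs_inner_hat_le (H1.toL2 (disp₀ y))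
  generalize (inverseDisp k₁ k₀ y).eval 0 = p
  generalize (disp₀ y).eval 0 = v
  generalize (inverseSlope k₁ k₀ y).eval 1 = m
  generalize ‖H1.toL2 (inverseSlope k₁ k₀ y)‖ = g
  generalize hL : (inner ℝ (H1.toL2 H1.hat) (H1.toL2 (disp₀ y)) : ℝ) = L at *
  generalize ‖H1.toL2 (disp₀ y)‖ = e at *
  generalize ‖H1.toL2 H1.hat‖ = Λ at *
  have h2 : 2 * γ * (L * v) ≤ 1 / 2 * e ^ 2 + 2 * γ ^ 2 * Λ ^ 2 * v ^ 2 := by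
    have h3 : L * v ≤ Λ * e * |v| := by
      refine (le_abs_self _).trans ?_
      rw [abs_mul]
      gcongr
    have h4 : 2 * γ * (L * v) ≤ 2 * γ * (Λ * e * |v|) := by gcongr
    have h5 : (e - 2 * γ * Λ * |v|) ^ 2
        = e ^ 2 - 4 * γ * (Λ * e * |v|) + 4 * γ ^ 2 * Λ ^ 2 * v ^ 2 := by
      rw [← sq_abs v]; ring
    linarith [sq_nonneg (e - 2 * γ * Λ * |v|)]
  have h3 : 2 * (k₁ * p + k₀ * v) ^ 2 ≤ 4 * k₁ ^ 2 * p ^ 2 + 4 * k₀ ^ 2 * v ^ 2 := by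
    linarith [sq_nonneg (k₁ * p - k₀ * v)]
  have h4 : (2 + 4 * k₀ ^ 2 + 2 * γ ^ 2 * Λ ^ 2) * v ^ 2 ≤ N * (2 * k₀) * v ^ 2 := by gcongr
  have h5 : (4 * k₁ ^ 2 + 1 / 2) * p ^ 2 ≤ 2 * γ * (1 + k₁) * p ^ 2 := by gcongr
  linarith [sq_nonneg g]

theorem norm_sq_le_lyapunov (hk₀ : 0 < k₀) {N γ : ℝ} (hγ : 0 < γ) (hN₁ : 4 ≤ N)
    (hN₂ : γ ^ 2 * ‖H1.toL2 H1.hat‖ ^ 2 + 1 ≤ N * k₁) (x : Energy0) :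
    ‖x‖ ^ 2 ≤ lyapunov k₁ k₀ N γ x x := by
  rw [lyapunov_apply, Submodule.coe_norm, norm_sq_eq_add, ← disp₀_apply, ← vel₀_apply,
    H1.inner_weight_comm (vel₀ x), real_inner_self_eq_norm_sq, real_inner_self_eq_norm_sq]
  have h1 := abs_inner_hat_le (vel₀ x)
  have h2 : |inner ℝ (H1.weight (disp₀ x).deriv) (vel₀ x)|
      ≤ 2 * ‖(disp₀ x).deriv‖ * ‖vel₀ x‖ :=
    (abs_real_inner_le_norm _ _).trans
      (mul_le_mul_of_nonneg_right (H1.norm_weight_le _) (norm_nonneg _))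
  have h3 := (abs_le.1 h2).1
  generalize (inner ℝ (H1.weight (disp₀ x).deriv) (vel₀ x) : ℝ) = W at *
  generalize (disp₀ x).eval 0 = p at *
  generalize ‖(disp₀ x).deriv‖ = g at *
  generalize (inner ℝ (H1.toL2 H1.hat) (vel₀ x) : ℝ) = L at *
  generalize ‖vel₀ x‖ = e at *
  generalize ‖H1.toL2 H1.hat‖ = Λ at *
  have h4 : -(2 * γ * (p * L)) ≤ e ^ 2 + γ ^ 2 * Λ ^ 2 * p ^ 2 := by
    have h5 : -(p * L) ≤ |p| * (Λ * e) := by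
      refine (neg_le_abs _).trans ?_
      rw [abs_mul]
      gcongr
    have h6 : 2 * γ * -(p * L) ≤ 2 * γ * (|p| * (Λ * e)) := by gcongr
    have h7 : (e - γ * Λ * |p|) ^ 2
        = e ^ 2 - 2 * γ * (|p| * (Λ * e)) + γ ^ 2 * Λ ^ 2 * p ^ 2 := by
      rw [← sq_abs p]; ring
    linarith [sq_nonneg (e - γ * Λ * |p|)]
  have h5 : (γ ^ 2 * Λ ^ 2 + 1) * p ^ 2 ≤ N * k₁ * p ^ 2 := by gcongr
  have h6 : 4 * (g ^ 2 + e ^ 2) ≤ N * (g ^ 2 + e ^ 2) := by gcongr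
  have h7 : 0 ≤ γ * k₀ * p ^ 2 := by positivity
  have h8 : 0 ≤ (g - e) ^ 2 := sq_nonneg _
  linarith [sq_nonneg g]

/-- Strict dissipativity of the generator for a suitable Lyapunov form. -/
theorem exists_isDissipativeInverse (hk₁ : 0 < k₁) (hk₀ : 0 < k₀) :
    ∃ Q : Energy0 →L[ℝ] Energy0 →L[ℝ] ℝ,
      IsDissipativeInverse (X := Energy0) (inverse k₀ hk₁) Q 1 ∧
      ∀ y, 2 * Q (inverse k₀ hk₁ y) y
        ≤ -((H1.evalOneL.comp (inverseSlope k₁ k₀)) y) ^ 2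
          - 1 / 2 * ‖inverse k₀ hk₁ y‖ ^ 2 := by
  -- `γ` is chosen such that the sum of the terms in `φ(0)²` is negative; a large `N` then absorbs
  -- the terms in `ψ(0)²` and makes the form coercive.
  obtain ⟨γ, hγ, hγ₁⟩ : ∃ γ : ℝ, 0 < γ ∧ 4 * k₁ ^ 2 + 1 / 2 ≤ 2 * γ * (1 + k₁) :=
    ⟨2 * k₁ + 1, by positivity, by nlinarith⟩
  obtain ⟨N, hN₁, hN₂, hN₃⟩ : ∃ N : ℝ, 4 ≤ N ∧ γ ^ 2 * ‖H1.toL2 H1.hat‖ ^ 2 + 1 ≤ N * k₁ ∧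
      2 + 4 * k₀ ^ 2 + 2 * γ ^ 2 * ‖H1.toL2 H1.hat‖ ^ 2 ≤ N * (2 * k₀) :=
    (((eventually_ge_atTop (4 : ℝ)).and
      ((tendsto_id.atTop_mul_const hk₁).eventually_ge_atTop _)).and
      ((tendsto_id.atTop_mul_const (by positivity : 0 < 2 * k₀)).eventually_ge_atTop _)).exists.imp
      fun _ h => ⟨h.1.1, h.1.2, h.2⟩
  have hdec := two_mul_lyapunov_inverse_le hk₁ hγ hγ₁ hN₃
  refine ⟨lyapunov k₁ k₀ N γ, ⟨fun x y => ?_, one_pos, fun x => ?_, fun y => ?_, fun y z h => ?_⟩,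
    hdec⟩
  · rw [lyapunov_apply, lyapunov_apply, real_inner_comm (disp₀ y).deriv,
      real_inner_comm (vel₀ y) (vel₀ x), H1.inner_weight_comm (vel₀ y),
      H1.inner_weight_comm (disp₀ y).deriv]
    ring
  · rw [one_mul]
    exact norm_sq_le_lyapunov hk₀ hγ hN₁ hN₂ x
  · have h1 := hdec y
    have h2 := sq_nonneg ((H1.evalOneL.comp (inverseSlope k₁ k₀)) y)
    have h3 := sq_nonneg ‖inverse k₀ hk₁ y‖
    linarith
  · have h1 := (mem_graph_iff_eq_inverse (k₀ := k₀) hk₁ _ y).2 rfl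
    have h2 := (mem_graph_iff_eq_inverse hk₁ _ z).2 h
    exact LinearPMap.mem_graph_snd_inj _ h1 h2 rfl

end Lyapunov

/-! ### Finite energy solutions and the integrated equation -/

theorem intervalIntegrable_of_continuousOn_Ici {E : Type*} [NormedAddCommGroup E] {u : ℝ → E}
    (hu : ContinuousOn u (Ici 0)) {t : ℝ} (ht : 0 ≤ t) : IntervalIntegrable u volume 0 t :=
  (hu.mono (by rw [uIcc_of_le ht]; exact Icc_subset_Ici_self)).intervalIntegrable

theorem weakForm_eq_inner {x : ℝ → Energy} (hx : ContinuousOn x (Ici 0)) {t : ℝ} (ht : 0 ≤ t)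
    (η : H1) : weakForm x t η = inner ℝ (vel (x t) - vel (x 0)) (H1.toL2 η)
      + inner ℝ (disp (∫ s in (0 : ℝ)..t, x s)).deriv η.deriv := by
  have h1 := ((innerSL ℝ η.deriv).comp (H1.derivL.comp dispL)).intervalIntegral_comp_comm
    (intervalIntegrable_of_continuousOn_Ici hx ht)
  have h2 : ∫ s in (0 : ℝ)..t, inner ℝ (disp (x s)).deriv η.deriv
      = inner ℝ (disp (∫ s in (0 : ℝ)..t, x s)).deriv η.deriv := by
    rw [real_inner_comm]
    refine Eq.trans (intervalIntegral.integral_congr fun s _ => ?_) h1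
    exact real_inner_comm _ _
  rw [weakForm, h2]

theorem weakForm_sub {x y : ℝ → Energy} (hx : ContinuousOn x (Ici 0))
    (hy : ContinuousOn y (Ici 0)) {t : ℝ} (ht : 0 ≤ t) (η : H1) :
    weakForm (fun t => x t - y t) t η = weakForm x t η - weakForm y t η := by
  have hxi := intervalIntegrable_of_continuousOn_Ici hx ht
  have hyi := intervalIntegrable_of_continuousOn_Ici hy ht
  have h1 : ∀ a b : Energy, (disp (a - b)).deriv = (disp a).deriv - (disp b).deriv :=
    fun _ _ => rfl
  rw [weakForm_eq_inner hx ht, weakForm_eq_inner hy ht,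
    weakForm_eq_inner (x := fun t => x t - y t) (hx.sub hy) ht,
    intervalIntegral.integral_sub hxi hyi, h1, vel_sub, vel_sub]
  simp only [inner_sub_left]
  ring

theorem HasLeftFlux.sub {x y : ℝ → Energy} {G K : ℝ → ℝ} (hx : ContinuousOn x (Ici 0))
    (hy : ContinuousOn y (Ici 0)) (hG : HasLeftFlux x G) (hK : HasLeftFlux y K) :
    HasLeftFlux (fun t => x t - y t) fun t => G t - K t := by
  intro t ht η hη
  rw [weakForm_sub hx hy ht, hG t ht η hη, hK t ht η hη]
  ring

theorem HasRightFlux.sub {x y : ℝ → Energy} {G K : ℝ → ℝ} (hx : ContinuousOn x (Ici 0))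
    (hy : ContinuousOn y (Ici 0)) (hG : HasRightFlux x G) (hK : HasRightFlux y K) :
    HasRightFlux (fun t => x t - y t) fun t => G t - K t := by
  intro t ht η hη
  rw [weakForm_sub hx hy ht, hG t ht η hη, hK t ht η hη]
  ring

/-- The right flux of a trajectory is unique. -/
theorem HasRightFlux.unique {x : ℝ → Energy} {G K : ℝ → ℝ} (hG : HasRightFlux x G)
    (hK : HasRightFlux x K) {t : ℝ} (ht : 0 ≤ t) : G t = K t := by
  set η := H1.mk 0 H1.constOne
  have h0 : η.eval 0 = 0 := H1.eval_zero_mk _ _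
  have h1 : η.eval 1 ≠ 0 := by
    rw [H1.eval_one_eq, h0, H1.deriv_mk, H1.inner_constOne_self]
    norm_num
  have h2 := (hG t ht η h0).symm.trans (hK t ht η h0)
  exact mul_right_cancel₀ h1 h2

/-- A finite energy solution of `y_tt = y_xx` with `y(1,t) = 0` and
`y_x(0,t) = k₁ y(0,t) + k₀ y_t(0,t)` satisfies the integrated evolution equation: the weak
formulation says that `∫₀ᵗ y_x ∈ H¹(0,1)`, with derivative `y_t(·,t) - y_t(·,0)` and the right value
at `0`. -/
theorem inverse_sub_eq_integral {k₁ k₀ : ℝ} (hk₁ : 0 < k₁) {β : ℝ → Energy0}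
    (hβ : ContinuousOn β (Ici 0))
    (hdisp : ∀ t, 0 ≤ t → H1.toL2 (disp (β t)) - H1.toL2 (disp (β 0))
      = ∫ s in (0 : ℝ)..t, vel (β s))
    (hleft : HasLeftFlux (fun t => (β t : Energy)) fun t =>
      (∫ s in (0 : ℝ)..t, k₁ * (disp (β s)).eval 0)
        + k₀ * ((disp (β t)).eval 0 - (disp (β 0)).eval 0)) {t : ℝ} (ht : 0 ≤ t) :
    inverse k₀ hk₁ (β t - β 0) = ∫ s in (0 : ℝ)..t, β s := by
  have hint := intervalIntegrable_of_continuousOn_Ici hβ ht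
  have hB : ((∫ s in (0 : ℝ)..t, β s : Energy0) : Energy) = ∫ s in (0 : ℝ)..t, (β s : Energy) :=
    (Energy0.subtypeL.intervalIntegral_comp_comm hint).symm
  have hv : vel₀ (∫ s in (0 : ℝ)..t, β s) = ∫ s in (0 : ℝ)..t, vel (β s) :=
    (vel₀.intervalIntegral_comp_comm hint).symm
  have hz : (disp₀ (∫ s in (0 : ℝ)..t, β s)).eval 0 = ∫ s in (0 : ℝ)..t, (disp (β s)).eval 0 := by
    rw [← H1.evalZeroL_apply]
    refine ((H1.evalZeroL.comp disp₀).intervalIntegral_comp_comm hint).symm.trans ?_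
    exact intervalIntegral.integral_congr fun s _ => H1.evalZeroL_apply _
  have hd0 : (disp₀ (β t - β 0)).eval 0 = (disp (β t)).eval 0 - (disp (β 0)).eval 0 := by
    rw [map_sub, ← H1.evalZeroL_apply, map_sub, H1.evalZeroL_apply, H1.evalZeroL_apply]
    rfl
  symm
  rw [← mem_graph_iff_eq_inverse, mem_graph_waveGenerator]
  set s := H1.mk (k₁ * (disp₀ (∫ s in (0 : ℝ)..t, β s)).eval 0
    + k₀ * (disp₀ (β t - β 0)).eval 0) (vel₀ (β t - β 0))
  refine ⟨s, ?_, ?_, H1.deriv_mk _ _, H1.eval_zero_mk _ _⟩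
  · rw [← sub_eq_zero]
    refine H1.eq_zero_of_inner_deriv fun η hη => ?_
    have h1 := hleft t ht η hη
    rw [weakForm_eq_inner (x := fun t => (β t : Energy))
      (continuous_subtype_val.comp_continuousOn hβ) ht, ← hB] at h1
    have h2 := H1.inner_deriv_add_inner s η
    rw [hη, H1.eval_zero_mk, H1.deriv_mk, hz, hd0] at h2
    beta_reduce at h1
    rw [intervalIntegral.integral_const_mul] at h1
    have h3 : vel₀ (β t - β 0) = vel (β t) - vel (β 0) := rfl
    rw [h3] at h2
    rw [inner_sub_left, disp₀_apply]
    linarith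
  · rw [hv, ← hdisp t ht, map_sub, map_sub]
    rfl

section Orbits

variable {k₁ k₀ : ℝ} {hk₁ : 0 < k₁} {Q : Energy0 →L[ℝ] Energy0 →L[ℝ] ℝ} {b : ℝ}

/-- The integrated Neumann trace at `1` of an orbit is the slope at `1` of
`∫₀ᵗ T(s) x ds = A⁻¹ (T(t) x - x)`. -/
theorem hasRightFlux_semigroup
    (h : IsDissipativeInverse (X := Energy0) (inverse k₀ hk₁) Q b) (x : Energy0) :
    HasRightFlux (fun t => (h.semigroup.toFun t.toNNReal x : Energy)) fun t =>
      H1.evalOneL.comp (inverseSlope k₁ k₀) (h.semigroup.toFun t.toNNReal x - x) := by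
  intro t ht η hη
  have hc := h.continuous_semigroup x
  have h0 : h.semigroup.toFun (0 : ℝ).toNNReal x = x := by
    rw [Real.toNNReal_zero, h.semigroup.map_zero]; rfl
  have hB : ∫ s in (0 : ℝ)..t, (h.semigroup.toFun s.toNNReal x : Energy)
      = (inverse k₀ hk₁ (h.semigroup.toFun t.toNNReal x - x) : Energy0) := by
    rw [h.apply_semigroup_sub ht]
    exact Energy0.subtypeL.intervalIntegral_comp_comm (hc.intervalIntegrable _ _)
  rw [weakForm_eq_inner (x := fun t => (h.semigroup.toFun t.toNNReal x : Energy))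
    (continuous_subtype_val.comp hc).continuousOn ht, hB, h0]
  set y := h.semigroup.toFun t.toNNReal x - x
  have h1 := H1.inner_deriv_add_inner (inverseSlope k₁ k₀ y) η
  rw [hη, deriv_inverseSlope, ← deriv_inverseDisp, ← disp₀_inverse hk₁] at h1
  beta_reduce
  rw [ContinuousLinearMap.comp_apply, H1.evalOneL_apply]
  have h2 : vel₀ y = vel (h.semigroup.toFun t.toNNReal x : Energy) - vel (x : Energy) := rfl
  rw [h2, disp₀_apply] at h1
  linarith

end Orbits

/-! ### The transport equation as a wave equation -/

/-- The state `(W, -W_x)` of a solution of `W_t = -W_x`, regarded as a solution of the wave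
equation. -/
def transportState (W : ℝ → H1) (t : ℝ) : Energy := mkState (W t) (-(W t).deriv)

theorem IsTransport.continuousOn_transportState {W : ℝ → H1} (hW : IsTransport W) :
    ContinuousOn (transportState W) (Ici 0) := by
  have h1 : Continuous fun φ : H1 => mkState φ (-φ.deriv) :=
    ((((WithLp.prodContinuousLinearEquiv 2 ℝ H1 L2).symm : H1 × L2 →L[ℝ] Energy).comp
      ((ContinuousLinearMap.id ℝ H1).prod (-H1.derivL)))).continuous
  exact h1.comp_continuousOn hW.continuousOn

theorem IsTransport.weakForm_transportState {W : ℝ → H1} (hW : IsTransport W) {t : ℝ}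
    (ht : 0 ≤ t) (η : H1) : weakForm (transportState W) t η
      = ((W 0).eval 1 - (W t).eval 1) * η.eval 1 - ((W 0).eval 0 - (W t).eval 0) * η.eval 0 := by
  have hint := intervalIntegrable_of_continuousOn_Ici hW.continuousOn_transportState ht
  have h1 : (disp (∫ s in (0 : ℝ)..t, transportState W s)).deriv
      = ∫ s in (0 : ℝ)..t, (W s).deriv :=
    ((H1.derivL.comp dispL).intervalIntegral_comp_comm hint).symm
  have h2 := hW.transport_eq t ht
  rw [← neg_eq_iff_eq_neg] at h2
  rw [weakForm_eq_inner hW.continuousOn_transportState ht, h1, ← h2]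
  have h3 := H1.inner_deriv_add_inner (W t) η
  have h4 := H1.inner_deriv_add_inner (W 0) η
  have h5 : ∀ s, vel (transportState W s) = -(W s).deriv := fun _ => rfl
  rw [h5, h5]
  simp only [inner_neg_left, inner_sub_left] at *
  linarith

/-- `transportState W` satisfies the relation between displacement and velocity of `IsWave`. -/
theorem IsTransport.disp_eq {W : ℝ → H1} (hW : IsTransport W) {t : ℝ} (ht : 0 ≤ t) :
    H1.toL2 (W t) - H1.toL2 (W 0) = ∫ s in (0 : ℝ)..t, vel (transportState W s) := by
  rw [hW.transport_eq t ht, ← intervalIntegral.integral_neg]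
  rfl

theorem IsTransport.hasLeftFlux {W : ℝ → H1} (hW : IsTransport W) :
    HasLeftFlux (transportState W) fun t => (W 0).eval 0 - (W t).eval 0 := fun t ht η hη => by
  rw [hW.weakForm_transportState ht, hη]
  ring

theorem IsTransport.hasRightFlux {W : ℝ → H1} (hW : IsTransport W) :
    HasRightFlux (transportState W) fun t => (W 0).eval 1 - (W t).eval 1 := fun t ht η hη => by
  rw [hW.weakForm_transportState ht, hη]
  ring

theorem pState_eq (w v : ℝ → Energy) (W : ℝ → H1) (t : ℝ) :
    pState w v W t = w t - v t - transportState W t := by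
  have h1 : vel (transportState W t) = -(W t).deriv := rfl
  refine state_ext ?_ ?_
  · rw [disp_sub, disp_sub]; rfl
  · rw [vel_sub, vel_sub, h1, sub_neg_eq_add]; rfl

/-! ### The error system of the disturbance estimator -/

theorem IsL2Loc.intervalIntegrable {g : ℝ → ℝ} (hg : IsL2Loc g) {t : ℝ} (ht : 0 ≤ t) :
    IntervalIntegrable g volume 0 t :=
  (intervalIntegrable_iff_integrableOn_Ioc_of_le ht).2 ((hg t).integrable (by norm_num))

theorem intervalIntegrable_totalDisturbance {f : Energy → ℝ} (hf : Continuous f) {d : ℝ → ℝ}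
    (hd : IsL2Loc d) {w : ℝ → Energy} (hw : ContinuousOn w (Ici 0)) {t : ℝ} (ht : 0 ≤ t) :
    IntervalIntegrable (totalDisturbance f d w) volume 0 t :=
  (intervalIntegrable_of_continuousOn_Ici (hf.comp_continuousOn hw) ht).add
    (hd.intervalIntegrable ht)

section ErrorSystem

variable {q c₀ c₁ : ℝ} {f : Energy → ℝ} {u d : ℝ → ℝ} {w v z : ℝ → Energy} {W : ℝ → H1}

theorem IsPlantWithEstimator.continuousOn_pState
    (h : IsPlantWithEstimator q c₀ c₁ f u d w v z W) :
    ContinuousOn (fun t => w t - v t - transportState W t) (Ici 0) :=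
  (h.w_wave.continuousOn.sub h.v_wave.continuousOn).sub h.W_transport.continuousOn_transportState

/-- The Neumann trace of `p` at `1` is the total disturbance: the control `u` cancels. -/
theorem IsPlantWithEstimator.hasRightFlux_pState
    (h : IsPlantWithEstimator q c₀ c₁ f u d w v z W) (hf : Continuous f) (hu : IsL2Loc u)
    (hd : IsL2Loc d) :
    HasRightFlux (fun t => w t - v t - transportState W t) fun t =>
      ∫ s in (0 : ℝ)..t, totalDisturbance f d w s := by
  intro t ht η hη
  have h1 := HasRightFlux.sub (x := fun t => w t - v t)
    (h.w_wave.continuousOn.sub h.v_wave.continuousOn) h.W_transport.continuousOn_transportState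
    (h.w_right.sub h.w_wave.continuousOn h.v_wave.continuousOn h.v_right)
    h.W_transport.hasRightFlux t ht η hη
  refine h1.trans ?_
  beta_reduce
  rw [intervalIntegral.integral_add (hu.intervalIntegrable ht)
      (intervalIntegrable_totalDisturbance hf hd h.w_wave.continuousOn ht)]
  ring

theorem intervalIntegrable_eval_zero {x : ℝ → Energy} (hx : ContinuousOn x (Ici 0)) {t : ℝ}
    (ht : 0 ≤ t) : IntervalIntegrable (fun s => (disp (x s)).eval 0) volume 0 t := by
  have h1 := intervalIntegrable_of_continuousOn_Ici
    ((H1.evalZeroL.comp dispL).continuous.comp_continuousOn hx) ht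
  refine h1.congr fun s _ => ?_
  exact H1.evalZeroL_apply _

/-- The boundary values of `p` at `0` are those of the target system, since
`p(0,t) = (1 - c₀) (w(0,t) - v(0,t))`. -/
theorem IsPlantWithEstimator.hasLeftFlux_error
    (h : IsPlantWithEstimator q c₀ c₁ f u d w v z W) (hc₀ : c₀ < 1) :
    HasLeftFlux (fun t => z t - (w t - v t - transportState W t)) fun t =>
      (∫ s in (0 : ℝ)..t,
        c₁ / (1 - c₀) * (disp (z s - (w s - v s - transportState W s))).eval 0)
      + c₀ / (1 - c₀) * ((disp (z t - (w t - v t - transportState W t))).eval 0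
        - (disp (z 0 - (w 0 - v 0 - transportState W 0))).eval 0) := by
  have hne : 1 - c₀ ≠ 0 := by linarith
  have hw := h.w_wave.continuousOn
  have hv := h.v_wave.continuousOn
  have hz := h.z_wave.continuousOn
  have hsub : ∀ φ ψ : H1, (φ - ψ).eval 0 = φ.eval 0 - ψ.eval 0 := fun φ ψ => by
    simp only [← H1.evalZeroL_apply, map_sub]
  have hval : ∀ t, 0 ≤ t → (disp (z t - (w t - v t - transportState W t))).eval 0
      = (disp (z t)).eval 0 - (1 - c₀) * ((disp (w t)).eval 0 - (disp (v t)).eval 0) := by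
    intro t ht
    have h1 : disp (transportState W t) = W t := rfl
    rw [disp_sub, disp_sub, disp_sub, h1, hsub, hsub, hsub, h.W_left t ht]
    ring
  intro t ht η hη
  have hp := HasLeftFlux.sub (x := fun t => w t - v t) (hw.sub hv)
    h.W_transport.continuousOn_transportState (h.w_left.sub hw hv h.v_left)
    h.W_transport.hasLeftFlux
  refine (h.z_left.sub hz h.continuousOn_pState hp t ht η hη).trans ?_
  beta_reduce
  have hwi := intervalIntegrable_eval_zero hw ht
  have hvi := intervalIntegrable_eval_zero hv ht
  have hzi := intervalIntegrable_eval_zero hz ht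
  have h1 : ∫ s in (0 : ℝ)..t,
        c₁ / (1 - c₀) * (disp (z s - (w s - v s - transportState W s))).eval 0
      = (∫ s in (0 : ℝ)..t, c₁ / (1 - c₀) * (disp (z s)).eval 0)
        - c₁ * ((∫ s in (0 : ℝ)..t, (disp (w s)).eval 0)
          - ∫ s in (0 : ℝ)..t, (disp (v s)).eval 0) := by
    rw [← intervalIntegral.integral_sub hwi hvi, ← intervalIntegral.integral_const_mul,
      ← intervalIntegral.integral_sub (hzi.const_mul _) ((hwi.sub hvi).const_mul _)]
    refine intervalIntegral.integral_congr fun s hs => ?_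
    rw [uIcc_of_le ht] at hs
    simp only [hval s hs.1]
    field_simp
  have h2 : ∫ s in (0 : ℝ)..t,
        (-q * (disp (w s)).eval 0 + c₁ * ((disp (v s)).eval 0 - (disp (w s)).eval 0))
      = (∫ s in (0 : ℝ)..t, -q * (disp (w s)).eval 0)
        + c₁ * ((∫ s in (0 : ℝ)..t, (disp (v s)).eval 0)
          - ∫ s in (0 : ℝ)..t, (disp (w s)).eval 0) := by
    rw [intervalIntegral.integral_add (hwi.const_mul _) ((hvi.sub hwi).const_mul _),
      intervalIntegral.integral_const_mul c₁, intervalIntegral.integral_sub hvi hwi]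
  rw [h1, h2, hval t ht, hval 0 le_rfl, h.W_left t ht, h.W_left 0 le_rfl]
  field_simp
  ring

theorem IsPlantWithEstimator.error_mem
    (h : IsPlantWithEstimator q c₀ c₁ f u d w v z W) {t : ℝ} (ht : 0 ≤ t) :
    z t - (w t - v t - transportState W t) ∈ Energy0 := by
  have hsub : ∀ φ ψ : H1, (φ - ψ).eval 1 = φ.eval 1 - ψ.eval 1 := fun φ ψ => by
    simp only [← H1.evalOneL_apply, map_sub]
  change (disp (z t) - (disp (w t) - disp (v t) - W t)).eval 1 = 0
  rw [hsub, hsub, hsub, h.z_right t ht]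
  ring

theorem IsPlantWithEstimator.disp_error_eq
    (h : IsPlantWithEstimator q c₀ c₁ f u d w v z W) {t : ℝ} (ht : 0 ≤ t) :
    H1.toL2 (disp (z t - (w t - v t - transportState W t)))
        - H1.toL2 (disp (z 0 - (w 0 - v 0 - transportState W 0)))
      = ∫ s in (0 : ℝ)..t, vel (z s - (w s - v s - transportState W s)) := by
  have hint : ∀ {x : ℝ → Energy}, ContinuousOn x (Ici 0) →
      IntervalIntegrable (fun s => vel (x s)) volume 0 t := fun hx =>
    intervalIntegrable_of_continuousOn_Ici (velL.continuous.comp_continuousOn hx) ht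
  have hw := hint h.w_wave.continuousOn
  have hv := hint h.v_wave.continuousOn
  have hz := hint h.z_wave.continuousOn
  have hW := hint h.W_transport.continuousOn_transportState
  have h1 : ∀ s, disp (transportState W s) = W s := fun _ => rfl
  simp only [disp_sub, vel_sub, map_sub, h1]
  rw [intervalIntegral.integral_sub hz ((hw.sub hv).sub hW),
    intervalIntegral.integral_sub (hw.sub hv) hW, intervalIntegral.integral_sub hw hv,
    ← h.z_wave.disp_eq t ht, ← h.w_wave.disp_eq t ht, ← h.v_wave.disp_eq t ht,
    ← h.W_transport.disp_eq ht]
  abel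

/-- The error `z - p` is an orbit of the semigroup. -/
theorem IsPlantWithEstimator.exists_error_eq_orbit
    (h : IsPlantWithEstimator q c₀ c₁ f u d w v z W) (hc₀ : c₀ < 1)
    {hk₁ : 0 < c₁ / (1 - c₀)} {Q : Energy0 →L[ℝ] Energy0 →L[ℝ] ℝ} {b : ℝ}
    (hR : IsDissipativeInverse (X := Energy0) (inverse (c₀ / (1 - c₀)) hk₁) Q b) :
    ∃ β₀ : Energy0, ∀ t : ℝ, 0 ≤ t →
      z t - (w t - v t - transportState W t) = hR.semigroup.toFun t.toNNReal β₀ := by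
  set e : ℝ → Energy := fun t => z t - (w t - v t - transportState W t)
  have hec : ContinuousOn e (Ici 0) := h.z_wave.continuousOn.sub h.continuousOn_pState
  set β : ℝ → Energy0 := fun t => ⟨e (max t 0), h.error_mem (le_max_right t 0)⟩
  have hβ : ∀ t, 0 ≤ t → (β t : Energy) = e t := fun t ht => by
    simp only [β, max_eq_left ht]
  have hβc : Continuous β := by
    refine Continuous.subtype_mk (continuousOn_univ.1 ?_) _
    exact hec.comp (by fun_prop) fun t _ => mem_Ici.2 (le_max_right t 0)
  have hflux : ∀ t, 0 ≤ t → ∀ η, weakForm (fun t => (β t : Energy)) t η = weakForm e t η := by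
    intro t ht η
    rw [weakForm, weakForm, hβ t ht, hβ 0 le_rfl]
    congr 1
    refine intervalIntegral.integral_congr fun s hs => ?_
    rw [uIcc_of_le ht] at hs
    simp only [hβ s hs.1]
  refine ⟨β 0, fun t ht => ?_⟩
  rw [← hR.eq_semigroup_of_integral_eq hβc.continuousOn (fun t ht => ?_) ht, hβ t ht]
  refine inverse_sub_eq_integral hk₁ hβc.continuousOn (fun t ht => ?_) (fun t ht η hη => ?_) ht
  · rw [hβ t ht, hβ 0 le_rfl, h.disp_error_eq ht]
    refine intervalIntegral.integral_congr fun s hs => ?_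
    rw [uIcc_of_le ht] at hs
    simp only [hβ s hs.1, e]
  · rw [hflux t ht, h.hasLeftFlux_error hc₀ t ht η hη]
    have h1 : ∫ s in (0 : ℝ)..t, c₁ / (1 - c₀) * (disp (β s)).eval 0
        = ∫ s in (0 : ℝ)..t, c₁ / (1 - c₀) * (disp (e s)).eval 0 := by
      refine intervalIntegral.integral_congr fun s hs => ?_
      rw [uIcc_of_le ht] at hs
      simp only [hβ s hs.1]
    beta_reduce
    rw [h1, hβ t ht, hβ 0 le_rfl]

end ErrorSystem

/-- Locally integrable functions on `[0,∞)` with the same primitive agree almost everywhere. -/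
theorem ae_eq_of_forall_intervalIntegral_eq {g h : ℝ → ℝ} (hg : ∀ τ : ℝ, IntegrableOn g (Ioc 0 τ))
    (hh : ∀ τ : ℝ, IntegrableOn h (Ioc 0 τ))
    (heq : ∀ t, 0 ≤ t → ∫ s in (0 : ℝ)..t, g s = ∫ s in (0 : ℝ)..t, h s) :
    g =ᵐ[volume.restrict (Ioi (0 : ℝ))] h := by
  have hi : ∀ {k : ℝ → ℝ}, (∀ τ : ℝ, IntegrableOn k (Ioc 0 τ)) → ∀ {t : ℝ}, 0 ≤ t →
      IntervalIntegrable k volume 0 t := fun hk _ ht =>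
    (intervalIntegrable_iff_integrableOn_Ioc_of_le ht).2 (hk _)
  refine (ae_restrict_iff' measurableSet_Ioi).2 ?_
  have h1 : ∀ᵐ x : ℝ, ∀ n : ℕ, x ∈ uIcc 0 (n : ℝ) → ∀ c ∈ uIcc 0 (n : ℝ),
      HasDerivAt (fun x => ∫ s in c..x, (g s - h s)) (g x - h x) x :=
    ae_all_iff.2 fun n =>
      ((hi hg n.cast_nonneg).sub (hi hh n.cast_nonneg)).ae_hasDerivAt_integral
  filter_upwards [h1] with x hx (hx0 : 0 < x)
  obtain ⟨n, hn⟩ := exists_nat_ge x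
  have h2 := hx n (by rw [uIcc_of_le n.cast_nonneg]; exact ⟨hx0.le, hn⟩) 0 left_mem_uIcc
  have h3 : HasDerivAt (fun x => ∫ s in (0 : ℝ)..x, (g s - h s)) 0 x := by
    refine (hasDerivAt_const x (0 : ℝ)).congr_of_eventuallyEq ?_
    filter_upwards [lt_mem_nhds hx0] with t ht
    rw [intervalIntegral.integral_sub (hi hg ht.le) (hi hh ht.le), heq t ht.le, sub_self]
  exact sub_eq_zero.1 (h2.unique h3)

end WaveEstimator

open WaveEstimator in
theorem lemma2p3 (c₀ c₁ : ℝ) (hc₀ : 0 < c₀) (hc₀' : c₀ < 1) (hc₁ : 0 < c₁) :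
    ∃ (T : WaveEstimator.C0Semigroup WaveEstimator.Energy0)
      (hT : T.HasGenerator (WaveEstimator.waveGenerator (c₁ / (1 - c₀)) (c₀ / (1 - c₀)))),
      T.ExponentiallyStable ∧
      hT.IsAdmissible (WaveEstimator.neumannObservation (c₁ / (1 - c₀)) (c₀ / (1 - c₀))) ∧
      ∃ Ψ : WaveEstimator.Energy0 →L[ℝ] Lp ℝ 2 (volume.restrict (Ioi (0 : ℝ))),
        (∀ x : (WaveEstimator.waveGenerator (c₁ / (1 - c₀)) (c₀ / (1 - c₀))).domain,
          Ψ x =ᵐ[volume.restrict (Ioi (0 : ℝ))] fun t =>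
            WaveEstimator.neumannObservation (c₁ / (1 - c₀)) (c₀ / (1 - c₀))
              (hT.orbit x t.toNNReal)) ∧
        (∀ x : WaveEstimator.Energy0, WaveEstimator.IsRightNeumannTrace
          (fun t => (T.toFun t.toNNReal x : WaveEstimator.Energy)) (Ψ x)) ∧
        ∀ (q : ℝ) (f : WaveEstimator.Energy → ℝ) (u d : ℝ → ℝ)
          (w v z : ℝ → WaveEstimator.Energy) (W : ℝ → WaveEstimator.H1),
          0 < q → Continuous f → WaveEstimator.IsL2Loc u → WaveEstimator.IsL2Loc d →
          WaveEstimator.IsPlantWithEstimator q c₀ c₁ f u d w v z W →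
          ∃ β₀ : WaveEstimator.Energy0,
            (∀ t : ℝ, 0 ≤ t → z t - WaveEstimator.pState w v W t = T.toFun t.toNNReal β₀) ∧
            (∃ Fhat : ℝ → ℝ, WaveEstimator.IsRightNeumannTrace z Fhat) ∧
            ∀ Fhat : ℝ → ℝ, WaveEstimator.IsRightNeumannTrace z Fhat →
              (fun t => Fhat t - WaveEstimator.totalDisturbance f d w t)
                =ᵐ[volume.restrict (Ioi (0 : ℝ))] Ψ β₀ ∧
              MemLp (fun t => Fhat t - WaveEstimator.totalDisturbance f d w t) 2
                (volume.restrict (Ioi (0 : ℝ))) := by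
  have hk₁ : 0 < c₁ / (1 - c₀) := div_pos hc₁ (by linarith)
  have hk₀ : 0 < c₀ / (1 - c₀) := div_pos hc₀ (by linarith)
  obtain ⟨Q, h, hdec⟩ := exists_isDissipativeInverse hk₁ hk₀
  have hω : (0 : ℝ) < 1 / 2 := by norm_num
  set R := inverse (c₀ / (1 - c₀)) hk₁ with hR
  have hA : ∀ x y, (x, y) ∈ (waveGenerator (c₁ / (1 - c₀)) (c₀ / (1 - c₀))).graph ↔ x = R y :=
    mem_graph_iff_eq_inverse hk₁
  have hgen := h.hasGenerator hA
  -- The observation at `A⁻¹ y` is the bounded functional `y ↦ (A⁻¹ y)_x(1)`.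
  have hobs : ∀ (x : (waveGenerator (c₁ / (1 - c₀)) (c₀ / (1 - c₀))).domain) (y : Energy0),
      (x : Energy0) = R y → neumannObservation (c₁ / (1 - c₀)) (c₀ / (1 - c₀)) x
        = H1.evalOneL.comp (inverseSlope (c₁ / (1 - c₀)) (c₀ / (1 - c₀))) y := by
    intro x y hxy
    rw [ContinuousLinearMap.comp_apply, H1.evalOneL_apply]
    refine neumannObservation_eq x ?_
    rw [hxy, hR, disp₀_inverse, deriv_inverseDisp]
  have hinv : ∀ x : (waveGenerator (c₁ / (1 - c₀)) (c₀ / (1 - c₀))).domain,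
      (x : Energy0) = R (waveGenerator _ _ x) := fun x => (hA _ _).1 (LinearPMap.mem_graph _ x)
  have horbit : ∀ (x : (waveGenerator (c₁ / (1 - c₀)) (c₀ / (1 - c₀))).domain) (t : ℝ≥0),
      neumannObservation (c₁ / (1 - c₀)) (c₀ / (1 - c₀)) (hgen.orbit x t)
        = H1.evalOneL.comp (inverseSlope (c₁ / (1 - c₀)) (c₀ / (1 - c₀)))
          (h.semigroup.toFun t (waveGenerator _ _ x)) := fun x t => by
    refine hobs _ _ ?_
    rw [h.apply_semigroup, ← hinv x]
    rfl
  -- The Neumann trace of every orbit is its extended output.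
  have htrace : ∀ x : Energy0, IsRightNeumannTrace
      (fun t => (h.semigroup.toFun t.toNNReal x : Energy)) (h.outputExt hω hdec x) := by
    refine fun x => ⟨fun τ => ?_, fun t ht η hη => ?_⟩
    · have h1 := (Lp.memLp (h.outputExt hω hdec x)).mono_measure
        (Measure.restrict_mono (show Ioc 0 τ ⊆ Ioi 0 from Ioc_subset_Ioi_self) le_rfl)
      exact h1.integrable (by norm_num)
    · beta_reduce
      rw [h.integral_outputExt hω hdec ht]
      exact hasRightFlux_semigroup h x t ht η hη
  refine ⟨h.semigroup, hgen, h.exponentiallyStable hω hdec, ⟨?_, fun τ _ => ?_⟩,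
    h.outputExt hω hdec, fun x => ?_, htrace, ?_⟩
  · obtain ⟨K, hK0, hK⟩ :=
      (H1.evalOneL.comp (inverseSlope (c₁ / (1 - c₀)) (c₀ / (1 - c₀)))).bound
    refine ⟨K, fun x => ?_⟩
    rw [hobs x _ (hinv x)]
    refine (hK _).trans (mul_le_mul_of_nonneg_left ?_ hK0.le)
    exact le_add_of_nonneg_left (norm_nonneg (x : Energy0))
  · obtain ⟨K, hK⟩ := h.exists_lintegral_observation_le hω hdec τ
    refine ⟨K, fun x => ?_⟩
    have h1 := hK (waveGenerator _ _ x)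
    rw [← hinv x] at h1
    simp only [horbit]
    exact h1
  · have h1 := h.outputExt_ae_eq hω hdec (waveGenerator _ _ x)
    rw [← hinv x] at h1
    simp only [horbit]
    exact h1
  · intro q f u d w v z W _ hf hu hd hsys
    obtain ⟨β₀, hβ₀⟩ := hsys.exists_error_eq_orbit hc₀' h
    have hF : ∀ τ : ℝ, IntegrableOn (totalDisturbance f d w) (Ioc 0 τ) := fun τ => by
      rcases le_total 0 τ with hτ | hτ
      · exact (intervalIntegrable_iff_integrableOn_Ioc_of_le hτ).1
          (intervalIntegrable_totalDisturbance hf hd hsys.w_wave.continuousOn hτ)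
      · simp [Ioc_eq_empty_of_le hτ]
    -- The right flux of `z` is the sum of those of `p` and of the error.
    have hflux : HasRightFlux z fun t => ∫ s in (0 : ℝ)..t,
        (totalDisturbance f d w s + h.outputExt hω hdec β₀ s) := by
      intro t ht η hη
      have h1 := weakForm_sub hsys.z_wave.continuousOn hsys.continuousOn_pState ht η
      rw [hsys.hasRightFlux_pState hf hu hd t ht η hη] at h1
      have h2 : weakForm (fun t => z t - (w t - v t - transportState W t)) t η
          = weakForm (fun t => (h.semigroup.toFun t.toNNReal β₀ : Energy)) t η := by
        rw [weakForm, weakForm, hβ₀ t ht, hβ₀ 0 le_rfl]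
        congr 1
        refine intervalIntegral.integral_congr fun s hs => ?_
        rw [uIcc_of_le ht] at hs
        simp only [hβ₀ s hs.1]
      rw [h2, (htrace β₀).2 t ht η hη] at h1
      beta_reduce at h1 ⊢
      rw [intervalIntegral.integral_add
        ((intervalIntegrable_iff_integrableOn_Ioc_of_le ht).2 (hF t))
        ((intervalIntegrable_iff_integrableOn_Ioc_of_le ht).2 ((htrace β₀).1 t))]
      linarith
    refine ⟨β₀, fun t ht => by rw [pState_eq, hβ₀ t ht],
      ⟨_, fun τ => (hF τ).add ((htrace β₀).1 τ), hflux⟩, fun Fhat hFhat => ?_⟩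
    have hae := ae_eq_of_forall_intervalIntegral_eq hFhat.1
      (fun τ => (hF τ).add ((htrace β₀).1 τ)) fun t ht => hFhat.2.unique hflux ht
    have hae' : (fun t => Fhat t - totalDisturbance f d w t)
        =ᵐ[volume.restrict (Ioi (0 : ℝ))] h.outputExt hω hdec β₀ := by
      filter_upwards [hae] with t ht
      rw [ht, Pi.add_apply, add_sub_cancel_left]
    exact ⟨hae', (Lp.memLp _).ae_eq hae'.symm⟩
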